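/- Let $n\ge 1$ and let $s_i=(i,i+1)$, $1\le i\le n-1$, be the simple transpositions of the symmetric group $S_n$. For $w\in S_n$ let $\ell(w)$ be the smallest $\ell$ for which $w$ is a product of $\ell$ simple transpositions; a reduced word for $w$ is a sequence $(e_1,\dots,e_{\ell(w)})$ in $\{1,\dots,n-1\}$ with $w=s_{e_1}\cdots s_{e_{\ell(w)}}$. The double Schubert polynomials $\mathfrak S_w(X;Y)\in\mathbb Z[x_1,x_2,\dots,y_1,y_2,\dots]$ are defined recursively: for the longest element $w_0\in S_n$, $\mathfrak S_{w_0}(X;Y)=\prod_{i,j\ge 1,\ i+j\le n}(x_i-y_j)$, and for $w\ne w_0$, $\mathfrak S_w(X;Y)=\partial_i\bigl(\mathfrak S_{ws_i}(X;Y)\bigr)$ for any $i$ with $\ell(ws_i)=\ell(w)+1$, where $\partial_i(f)=\dfrac{f-f|_{x_i\leftrightarrow x_{i+1}}}{x_i-x_{i+1}}$ (the result does not depend on the choice of $i$). **Corollary.** Let $w\in S_n$ and let $x^uy^v=x_1^{u_1}\cdots x_{n-1}^{u_{n-1}}y_1^{v_1}\cdots y_{n-1}^{v_{n-1}}$ be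 a monomial of total degree $\ell(w)$. For $0\le i\le n-1$ set $g_i=\sum_{k=n-i}^{n-1}v_k$ and $f_i=g_{n-1}+\sum_{k=1}^{i}u_k$ (so $g_0=0$ and $f_0=g_{n-1}$). Then the coefficient of $x^uy^v$ in $\mathfrak S_w(X;Y)$ equals $(-1)^{g_{n-1}}$ times the number of reduced words $(e_1,\dots,e_{\ell(w)})$ for $w$ such that, for all $1\le i\le n-1$, $$n-i\le e_{g_{i-1}+1}<e_{g_{i-1}+2}<\dots<e_{g_i}\qquad\text{and}\qquad e_{f_{i-1}+1}>e_{f_{i-1}+2}>\dots>e_{f_i}\ge i .$$ Here a chain of inequalities imposes no condition when its block of indices is empty, that is, when $g_{i-1}=g_i$, respectively $f_{i-1}=f_i$. -/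

import Mathlib

namespace DoubleSchubert

/-! ### Reduced words in the symmetric group

The symmetric group on `n` letters is `Equiv.Perm (Fin n)`; the element `k : Fin n` stands for the
letter `k + 1`. Simple transpositions are indexed by `1 ≤ i ≤ n - 1`. -/

/-- The simple transposition `s_i = (i, i + 1)` for `1 ≤ i < n`, and the identity for other `i`.
Letter `i` of `{1, …, n}` is the element `i - 1` of `Fin n`. -/
def simple (n i : ℕ) : Equiv.Perm (Fin n) :=
  if h : 1 ≤ i ∧ i < n then Equiv.swap ⟨i - 1, by omega⟩ ⟨i, h.2⟩ else 1

/-- `e = (e_1, …, e_l)` is a word for `w`: all `e_k` lie in `{1, …, n - 1}` and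
`w = s_{e_1} s_{e_2} ⋯ s_{e_l}`. -/
def IsWord {n : ℕ} (w : Equiv.Perm (Fin n)) (e : List ℕ) : Prop :=
  (∀ a ∈ e, 1 ≤ a ∧ a < n) ∧ (e.map (simple n)).prod = w

/-- The length `ℓ(w)`: the smallest number of simple transpositions with product `w`. -/
noncomputable def len {n : ℕ} (w : Equiv.Perm (Fin n)) : ℕ :=
  sInf {k | ∃ e : List ℕ, IsWord w e ∧ e.length = k}

/-- A reduced word for `w`: a word for `w` with exactly `ℓ(w)` letters. -/
def IsReducedWord {n : ℕ} (w : Equiv.Perm (Fin n)) (e : List ℕ) : Prop :=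
  IsWord w e ∧ e.length = len w

/-- `s_i` is a simple transposition with `ℓ(w s_i) = ℓ(w) + 1`. -/
def IsAscent {n : ℕ} (w : Equiv.Perm (Fin n)) (i : ℕ) : Prop :=
  1 ≤ i ∧ i < n ∧ len (w * simple n i) = len w + 1

/-! ### Divided differences

Polynomials have integer coefficients and variables indexed by `ℕ ⊕ ℕ`: `x_i` is the variable
`Sum.inl i` and `y_j` is the variable `Sum.inr j` (only indices `≥ 1` occur). -/

/-- The polynomial ring `ℤ[x_1, x_2, …, y_1, y_2, …]`. -/
abbrev Poly : Type := MvPolynomial (ℕ ⊕ ℕ) ℤ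

/-- The variable `x_i`. -/
noncomputable def x (i : ℕ) : Poly := MvPolynomial.X (Sum.inl i)

/-- The variable `y_j`. -/
noncomputable def y (j : ℕ) : Poly := MvPolynomial.X (Sum.inr j)

/-- The exchange of the variables `x_i` and `x_{i+1}`. -/
noncomputable def exch (i : ℕ) : Poly →ₐ[ℤ] Poly :=
  MvPolynomial.rename (Equiv.swap (Sum.inl i) (Sum.inl (i + 1)))

theorem x_sub_dvd (i : ℕ) (f : Poly) : (x i - x (i + 1)) ∣ f - exch i f := by
  rw [← Ideal.mem_span_singleton, ← Ideal.Quotient.mk_eq_mk_iff_sub_mem]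
  set I : Ideal Poly := Ideal.span {x i - x (i + 1)} with hI
  have hx : Ideal.Quotient.mk I (x i) = Ideal.Quotient.mk I (x (i + 1)) := by
    rw [Ideal.Quotient.mk_eq_mk_iff_sub_mem]
    exact Ideal.subset_span rfl
  have key : (Ideal.Quotient.mkₐ ℤ I) = (Ideal.Quotient.mkₐ ℤ I).comp (exch i) := by
    apply MvPolynomial.algHom_ext
    intro j
    simp only [AlgHom.comp_apply, exch, MvPolynomial.rename_X, Ideal.Quotient.mkₐ_eq_mk]
    by_cases h1 : j = Sum.inl i
    · subst h1; rw [Equiv.swap_apply_left]; exact hx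
    by_cases h2 : j = Sum.inl (i + 1)
    · subst h2; rw [Equiv.swap_apply_right]; exact hx.symm
    rw [Equiv.swap_apply_of_ne_of_ne h1 h2]
  exact DFunLike.congr_fun key f

/-- The divided difference `∂_i f = (f - f(x_i ↔ x_{i+1})) / (x_i - x_{i+1})`. -/
noncomputable def divDiff (i : ℕ) (f : Poly) : Poly := (x_sub_dvd i f).choose

theorem divDiff_spec (i : ℕ) (f : Poly) :
    (x i - x (i + 1)) * divDiff i f = f - exch i f :=
  (x_sub_dvd i f).choose_spec.symm

/-! ### Double Schubert polynomials -/

/-- The polynomial `∏_{i + j ≤ n} (x_i - y_j)`, the product being over `i, j ≥ 1`. -/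
noncomputable def topPoly (n : ℕ) : Poly :=
  ∏ p ∈ (Finset.Icc 1 n ×ˢ Finset.Icc 1 n).filter (fun p => p.1 + p.2 ≤ n), (x p.1 - y p.2)

open Classical in
/-- The double Schubert polynomial of `w`. For the longest permutation `w_0` (the reversal) it is
`∏_{i + j ≤ n} (x_i - y_j)`; for another `w` it is `∂_i` of the double Schubert polynomial of
`w s_i`, where `s_i` is a simple transposition with `ℓ(w s_i) = ℓ(w) + 1`. The last branch never
occurs (`exists_isAscent`), and any such `s_i` gives the same result (`doubleSchubert_eq`). -/
noncomputable def doubleSchubert {n : ℕ} (w : Equiv.Perm (Fin n)) : Poly :=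
  if w = Fin.revPerm then topPoly n
  else if h : ∃ i, IsAscent w i then
    divDiff h.choose (doubleSchubert (w * simple n h.choose))
  else 0
termination_by (Finset.univ.sup (len (n := n))) - len w
decreasing_by
  have h1 := h.choose_spec.2.2
  have h2 : len (w * simple n h.choose) ≤ Finset.univ.sup (len (n := n)) :=
    Finset.le_sup (Finset.mem_univ _)
  omega

/-! #### The length counts inversions -/

theorem simple_eq {n i : ℕ} (h1 : 1 ≤ i) (h2 : i < n) :
    simple n i = Equiv.swap ⟨i - 1, by omega⟩ ⟨i, h2⟩ := by
  simp [simple, h1, h2]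

theorem simple_mul_self (n i : ℕ) : simple n i * simple n i = 1 := by
  unfold simple; split <;> simp

/-- The set of inversions of `w`. -/
def invSet {n : ℕ} (w : Equiv.Perm (Fin n)) : Finset (Fin n × Fin n) :=
  Finset.univ.filter (fun p => p.1 < p.2 ∧ w p.2 < w p.1)

theorem mem_invSet {n : ℕ} (w : Equiv.Perm (Fin n)) (a b : Fin n) :
    (a, b) ∈ invSet w ↔ a < b ∧ w b < w a := by
  simp [invSet]

theorem simple_lt {n i : ℕ} (h1 : 1 ≤ i) (h2 : i < n) {a b : Fin n} (hab : a < b)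
    (hne : ¬ (a.val = i - 1 ∧ b.val = i)) : simple n i a < simple n i b := by
  rw [simple_eq h1 h2, Equiv.swap_apply_def, Equiv.swap_apply_def]
  simp only [Fin.ext_iff, Fin.lt_def] at *
  split_ifs <;> (try simp only) <;> omega

theorem card_invSet_mul {n i : ℕ} (w : Equiv.Perm (Fin n)) (h1 : 1 ≤ i) (h2 : i < n)
    (hw : w ⟨i - 1, by omega⟩ < w ⟨i, h2⟩) :
    (invSet (w * simple n i)).card = (invSet w).card + 1 := by
  set s := simple n i with hs
  have hsl : s ⟨i - 1, by omega⟩ = ⟨i, h2⟩ := by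
    rw [hs, simple_eq h1 h2, Equiv.swap_apply_left]
  have hsr : s ⟨i, h2⟩ = ⟨i - 1, by omega⟩ := by
    rw [hs, simple_eq h1 h2, Equiv.swap_apply_right]
  have hss : ∀ a, s (s a) = a := fun a => by
    rw [← Equiv.Perm.mul_apply, hs, simple_mul_self]; rfl
  have key : invSet (w * s) =
      insert (⟨i - 1, by omega⟩, ⟨i, h2⟩)
        ((invSet w).map (s.prodCongr s).toEmbedding) := by
    ext ⟨a, b⟩
    simp only [mem_invSet, Finset.mem_insert, Finset.mem_map, Equiv.coe_toEmbedding, Prod.exists, Equiv.prodCongr_apply, Prod.map,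
      Prod.mk.injEq, Equiv.Perm.mul_apply]
    constructor
    · rintro ⟨hab, hlt⟩
      by_cases hc : a.val = i - 1 ∧ b.val = i
      · left; exact ⟨Fin.ext hc.1, Fin.ext hc.2⟩
      · right
        exact ⟨s a, s b, ⟨simple_lt h1 h2 hab hc, hlt⟩, hss a, hss b⟩
    · rintro (⟨rfl, rfl⟩ | ⟨c, d, ⟨hcd, hlt⟩, rfl, rfl⟩)
      · rw [hsl, hsr]
        exact ⟨by simp only [Fin.lt_def]; omega, hw⟩
      · rw [hss, hss]
        refine ⟨simple_lt h1 h2 hcd ?_, hlt⟩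
        rintro ⟨hc, hd⟩
        have e1 : c = ⟨i - 1, by omega⟩ := Fin.ext hc
        have e2 : d = ⟨i, h2⟩ := Fin.ext hd
        rw [e1, e2] at hlt
        exact absurd hlt (not_lt.2 hw.le)
  rw [key, Finset.card_insert_of_notMem, Finset.card_map]
  simp only [mem_invSet, Finset.mem_map, Equiv.coe_toEmbedding, Prod.exists, Equiv.prodCongr_apply, Prod.map, Prod.mk.injEq, not_exists,
    not_and, and_imp]
  intro c d hcd _ hc hd
  have e1 : c = ⟨i, h2⟩ := by rw [← hss c, hc, hsl]
  have e2 : d = ⟨i - 1, by omega⟩ := by rw [← hss d, hd, hsr]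
  rw [e1, e2] at hcd
  simp only [Fin.lt_def] at hcd
  omega

theorem card_invSet_mul_of_gt {n i : ℕ} (w : Equiv.Perm (Fin n)) (h1 : 1 ≤ i) (h2 : i < n)
    (hw : w ⟨i, h2⟩ < w ⟨i - 1, by omega⟩) :
    (invSet w).card = (invSet (w * simple n i)).card + 1 := by
  have := card_invSet_mul (w * simple n i) h1 h2 (by
    rw [Equiv.Perm.mul_apply, Equiv.Perm.mul_apply, simple_eq h1 h2, Equiv.swap_apply_left,
      Equiv.swap_apply_right]
    exact hw)
  rwa [mul_assoc, simple_mul_self, mul_one] at this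

theorem card_invSet_le {n : ℕ} (w : Equiv.Perm (Fin n)) {i : ℕ} (h1 : 1 ≤ i) (h2 : i < n) :
    (invSet (w * simple n i)).card ≤ (invSet w).card + 1 := by
  rcases lt_trichotomy (w ⟨i - 1, by omega⟩) (w ⟨i, h2⟩) with h | h | h
  · exact (card_invSet_mul w h1 h2 h).le
  · have := w.injective h
    simp only [Fin.mk.injEq] at this
    omega
  · have := card_invSet_mul_of_gt w h1 h2 h
    omega

theorem eq_one_of_no_descent {n : ℕ} (w : Equiv.Perm (Fin n))
    (h : ∀ i (h1 : 1 ≤ i) (h2 : i < n), w ⟨i - 1, by omega⟩ < w ⟨i, h2⟩) : w = 1 := by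
  cases n with
  | zero => exact Subsingleton.elim _ _
  | succ m =>
    have hm : StrictMono w := by
      rw [Fin.strictMono_iff_lt_succ]
      intro i
      exact h (i.val + 1) (by omega) (by omega)
    have := Subsingleton.elim (hm.orderIsoOfSurjective w w.surjective) (OrderIso.refl _)
    ext i
    have h2 := DFunLike.congr_fun this i
    simpa using congrArg Fin.val h2

theorem card_invSet_one (n : ℕ) : (invSet (1 : Equiv.Perm (Fin n))).card = 0 := by
  rw [Finset.card_eq_zero, invSet, Finset.filter_eq_empty_iff]
  rintro ⟨a, b⟩ _ ⟨h1, h2⟩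
  exact absurd h1 (not_lt.2 h2.le)

theorem card_invSet_le_length {n : ℕ} (e : List ℕ) (he : ∀ a ∈ e, 1 ≤ a ∧ a < n) :
    (invSet ((e.map (simple n)).prod)).card ≤ e.length := by
  induction e using List.reverseRecOn with
  | nil => simp [card_invSet_one]
  | append_singleton e a ih =>
    have ha := he a (by simp)
    have := ih (fun b hb => he b (by simp [hb]))
    simp only [List.map_append, List.map_cons, List.map_nil, List.prod_append, List.prod_cons,
      List.prod_nil, mul_one, List.length_append, List.length_cons, List.length_nil]
    have h3 := card_invSet_le (e.map (simple n)).prod ha.1 ha.2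
    omega

theorem exists_word {n : ℕ} (k : ℕ) (w : Equiv.Perm (Fin n)) (hk : (invSet w).card = k) :
    ∃ e, IsWord w e ∧ e.length = k := by
  induction k generalizing w with
  | zero =>
    have : w = 1 := by
      apply eq_one_of_no_descent
      intro i h1 h2
      by_contra hc
      have hne : w ⟨i, h2⟩ ≠ w ⟨i - 1, by omega⟩ := fun h => by
        have := w.injective h
        simp only [Fin.mk.injEq] at this
        omega
      have := card_invSet_mul_of_gt w h1 h2 (lt_of_le_of_ne (not_lt.1 hc) hne)
      omega
    exact ⟨[], ⟨by simp, by simp [this]⟩, rfl⟩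
  | succ k ih =>
    have : ∃ i, ∃ (h1 : 1 ≤ i) (h2 : i < n), w ⟨i, h2⟩ < w ⟨i - 1, by omega⟩ := by
      by_contra hc
      push Not at hc
      have h1 : w = 1 := by
        apply eq_one_of_no_descent
        intro i h1 h2
        refine lt_of_le_of_ne (hc i h1 h2) fun h => ?_
        have := w.injective h
        simp only [Fin.mk.injEq] at this
        omega
      rw [h1, card_invSet_one] at hk
      omega
    obtain ⟨i, h1, h2, hlt⟩ := this
    have hc := card_invSet_mul_of_gt w h1 h2 hlt
    obtain ⟨e, ⟨he1, he2⟩, he3⟩ := ih (w * simple n i) (by omega)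
    refine ⟨e ++ [i], ⟨?_, ?_⟩, by simp [he3]⟩
    · intro a ha
      rcases List.mem_append.1 ha with ha | ha
      · exact he1 a ha
      · rw [List.mem_singleton] at ha
        subst ha
        exact ⟨h1, h2⟩
    · simp [he2, mul_assoc, simple_mul_self]

theorem len_eq {n : ℕ} (w : Equiv.Perm (Fin n)) : len w = (invSet w).card := by
  obtain ⟨e, he, hl⟩ := exists_word _ w rfl
  apply le_antisymm
  · exact Nat.sInf_le ⟨e, he, hl⟩
  · refine le_csInf ⟨_, e, he, hl⟩ ?_
    rintro k ⟨e', ⟨h1, h2⟩, rfl⟩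
    have := card_invSet_le_length e' h1
    rwa [h2] at this

theorem isAscent_iff {n : ℕ} (w : Equiv.Perm (Fin n)) (i : ℕ) :
    IsAscent w i ↔ ∃ (_ : 1 ≤ i) (h2 : i < n), w ⟨i - 1, by omega⟩ < w ⟨i, h2⟩ := by
  constructor
  · rintro ⟨h1, h2, h3⟩
    refine ⟨h1, h2, ?_⟩
    by_contra hc
    have hne : w ⟨i, h2⟩ ≠ w ⟨i - 1, by omega⟩ := fun h => by
      have := w.injective h
      simp only [Fin.mk.injEq] at this
      omega
    have := card_invSet_mul_of_gt w h1 h2 (lt_of_le_of_ne (not_lt.1 hc) hne)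
    rw [len_eq, len_eq] at h3
    omega
  · rintro ⟨h1, h2, h3⟩
    exact ⟨h1, h2, by rw [len_eq, len_eq]; exact card_invSet_mul w h1 h2 h3⟩

theorem not_isAscent_rev {n : ℕ} (i : ℕ) : ¬ IsAscent (Fin.revPerm : Equiv.Perm (Fin n)) i := by
  rw [isAscent_iff]
  rintro ⟨h1, h2, h3⟩
  rw [Fin.revPerm_apply, Fin.revPerm_apply, Fin.rev_lt_rev, Fin.lt_def] at h3
  simp only at h3
  omega

theorem exists_isAscent {n : ℕ} (w : Equiv.Perm (Fin n)) (hw : w ≠ Fin.revPerm) :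
    ∃ i, IsAscent w i := by
  by_contra hc
  apply hw
  have h1 : Fin.revPerm * w = 1 := by
    apply eq_one_of_no_descent
    intro i h1 h2
    rw [Equiv.Perm.mul_apply, Equiv.Perm.mul_apply, Fin.revPerm_apply, Fin.revPerm_apply,
      Fin.rev_lt_rev]
    refine lt_of_le_of_ne (not_lt.1 fun h => hc ⟨i, (isAscent_iff w i).2 ⟨h1, h2, h⟩⟩) fun h => ?_
    have := w.injective h
    simp only [Fin.mk.injEq] at this
    omega
  have h2 : (Fin.revPerm : Equiv.Perm (Fin n)) * Fin.revPerm = 1 := by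
    ext a; simp
  calc w = (Fin.revPerm * Fin.revPerm) * w := by rw [h2, one_mul]
    _ = Fin.revPerm := by rw [mul_assoc, h1, mul_one]

/-! #### Independence of the choices -/

theorem x_sub_ne {i j : ℕ} (h : i ≠ j) : x i - x j ≠ 0 := by
  intro h0
  have := MvPolynomial.X_injective (R := ℤ) (sub_eq_zero.1 h0)
  exact h (Sum.inl.inj this)

theorem exch_x (i j : ℕ) : exch i (x j) = if j = i then x (i + 1) else if j = i + 1 then x i
    else x j := by
  unfold exch x
  rw [MvPolynomial.rename_X]
  split_ifs with h1 h2
  · subst h1; rw [Equiv.swap_apply_left]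
  · subst h2; rw [Equiv.swap_apply_right]
  · rw [Equiv.swap_apply_of_ne_of_ne] <;> simp [h1, h2]

theorem swap_inl (a b k : ℕ) : Equiv.swap (Sum.inl a : ℕ ⊕ ℕ) (Sum.inl b) (Sum.inl k) =
    Sum.inl (if k = a then b else if k = b then a else k) := by
  rw [Equiv.swap_apply_def]
  simp only [Sum.inl.injEq]
  split_ifs <;> rfl

theorem swap_inr (a b k : ℕ) : Equiv.swap (Sum.inl a : ℕ ⊕ ℕ) (Sum.inl b) (Sum.inr k) =
    Sum.inr k :=
  Equiv.swap_apply_of_ne_of_ne (by simp) (by simp)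

theorem exch_exch (i : ℕ) (f : Poly) : exch i (exch i f) = f := by
  unfold exch
  rw [MvPolynomial.rename_rename]
  have : (Equiv.swap (Sum.inl i : ℕ ⊕ ℕ) (Sum.inl (i + 1))) ∘
      (Equiv.swap (Sum.inl i : ℕ ⊕ ℕ) (Sum.inl (i + 1))) = id := by
    funext k
    simp
  rw [this, MvPolynomial.rename_id_apply]

theorem exch_comm {i j : ℕ} (h : i + 2 ≤ j) (f : Poly) :
    exch i (exch j f) = exch j (exch i f) := by
  unfold exch
  rw [MvPolynomial.rename_rename, MvPolynomial.rename_rename]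
  congr 2
  funext k
  rcases k with k | k
  · simp only [Function.comp, swap_inl]
    congr 1
    split_ifs <;> omega
  · simp only [Function.comp, swap_inr]

theorem exch_braid (i : ℕ) (f : Poly) :
    exch i (exch (i + 1) (exch i f)) = exch (i + 1) (exch i (exch (i + 1) f)) := by
  unfold exch
  simp only [MvPolynomial.rename_rename]
  congr 2
  funext k
  rcases k with k | k
  · simp only [Function.comp, swap_inl]
    congr 1
    split_ifs <;> omega
  · simp only [Function.comp, swap_inr]

theorem divDiff_comm {i j : ℕ} (h : i + 2 ≤ j) (f : Poly) :
    divDiff i (divDiff j f) = divDiff j (divDiff i f) := by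
  have a1 := divDiff_spec i (divDiff j f)
  have a2 := divDiff_spec j (divDiff i f)
  have a3 := divDiff_spec i f
  have a4 := divDiff_spec j f
  have a5 := congrArg (exch i) a4
  have a6 := congrArg (exch j) a3
  simp only [map_mul, map_sub, exch_x] at a5 a6
  rw [if_neg (by omega), if_neg (by omega), if_neg (by omega), if_neg (by omega)] at a5 a6
  rw [← exch_comm h] at a6
  apply mul_left_cancel₀ (x_sub_ne (show i ≠ i + 1 by omega))
  apply mul_left_cancel₀ (x_sub_ne (show j ≠ j + 1 by omega))
  linear_combination (x j - x (j + 1)) * a1 - (x i - x (i + 1)) * a2 + a4 - a5 - a3 + a6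

theorem divDiff_braid (i : ℕ) (f : Poly) :
    divDiff i (divDiff (i + 1) (divDiff i f)) =
      divDiff (i + 1) (divDiff i (divDiff (i + 1) f)) := by
  have l1 := divDiff_spec i f
  have l2 := divDiff_spec (i + 1) (divDiff i f)
  have l3 := divDiff_spec i (divDiff (i + 1) (divDiff i f))
  have r1 := divDiff_spec (i + 1) f
  have r2 := divDiff_spec i (divDiff (i + 1) f)
  have r3 := divDiff_spec (i + 1) (divDiff i (divDiff (i + 1) f))
  have l11 := congrArg (exch i) l1
  have r22 := congrArg (exch (i + 1)) r1
  have l12 := congrArg (exch (i + 1)) l1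
  have l21 := congrArg (exch i) l2
  have l121 := congrArg (exch i) l12
  have r12 := congrArg (exch i) r1
  have r21 := congrArg (exch (i + 1)) r2
  have r121 := congrArg (exch (i + 1)) r12
  have hb := exch_braid i f
  have e1 : exch i (x i) = x (i + 1) := by simp [exch_x]
  have e2 : exch i (x (i + 1)) = x i := by simp [exch_x]
  have e3 : exch i (x (i + 1 + 1)) = x (i + 1 + 1) := by
    rw [exch_x, if_neg (by omega), if_neg (by omega)]
  have e4 : exch (i + 1) (x i) = x i := by
    rw [exch_x, if_neg (by omega), if_neg (by omega)]
  have e5 : exch (i + 1) (x (i + 1)) = x (i + 1 + 1) := by simp [exch_x]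
  have e6 : exch (i + 1) (x (i + 1 + 1)) = x (i + 1) := by simp [exch_x]
  simp only [map_mul, map_sub, exch_exch, e1, e2, e3, e4, e5, e6] at l11 l12 l21 l121 r22 r12 r21 r121
  have hab := x_sub_ne (show i ≠ i + 1 by omega)
  have hac := x_sub_ne (show i ≠ i + 1 + 1 by omega)
  have hbc := x_sub_ne (show i + 1 ≠ i + 1 + 1 by omega)
  generalize x i = a at *
  generalize x (i + 1) = b at *
  generalize x (i + 1 + 1) = c at *
  have L : (a - b) * (b - c) * (a - c) * divDiff i (divDiff (i + 1) (divDiff i f)) =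
      f - exch i f - exch (i + 1) f + exch i (exch (i + 1) f) + exch (i + 1) (exch i f)
        - exch i (exch (i + 1) (exch i f)) := by
    apply mul_left_cancel₀ hab
    linear_combination (a - b) * (b - c) * (a - c) * l3 + (a - b) * (a - c) * l2 + (a - c) * l1
      - (a - b) * l12 - (a - b) * (b - c) * l21 + (b - c) * l11 + (a - b) * l121
  have R : (a - b) * (b - c) * (a - c) * divDiff (i + 1) (divDiff i (divDiff (i + 1) f)) =
      f - exch i f - exch (i + 1) f + exch i (exch (i + 1) f) + exch (i + 1) (exch i f)
        - exch i (exch (i + 1) (exch i f)) := by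
    apply mul_left_cancel₀ hbc
    linear_combination (a - b) * (b - c) * (a - c) * r3 + (b - c) * (a - c) * r2 + (a - c) * r1
      - (b - c) * r12 - (a - b) * (b - c) * r21 + (a - b) * r22 + (b - c) * r121 + (b - c) * hb
  exact mul_left_cancel₀ (mul_ne_zero (mul_ne_zero hab hbc) hac) (L.trans R.symm)

theorem isAscent_mul_far {n i j : ℕ} {w : Equiv.Perm (Fin n)} (h : i + 2 ≤ j ∨ j + 2 ≤ i)
    (hi : IsAscent w i) (hj : IsAscent w j) : IsAscent (w * simple n i) j := by
  rw [isAscent_iff] at hi hj ⊢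
  obtain ⟨i1, i2, _⟩ := hi
  obtain ⟨j1, j2, j3⟩ := hj
  refine ⟨j1, j2, ?_⟩
  rw [Equiv.Perm.mul_apply, Equiv.Perm.mul_apply, simple_eq i1 i2,
    Equiv.swap_apply_of_ne_of_ne, Equiv.swap_apply_of_ne_of_ne]
  · exact j3
  all_goals
    simp only [ne_eq, Fin.mk.injEq]
    omega

theorem simple_comm {n i j : ℕ} (hi1 : 1 ≤ i) (hi2 : i < n) (hj1 : 1 ≤ j) (hj2 : j < n)
    (h : i + 2 ≤ j) : simple n i * simple n j = simple n j * simple n i := by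
  rw [simple_eq hi1 hi2, simple_eq hj1 hj2]
  ext k
  simp only [Equiv.Perm.mul_apply, Equiv.swap_apply_def, Fin.ext_iff]
  split_ifs <;> simp only at * <;> omega

theorem simple_braid {n i : ℕ} (hi1 : 1 ≤ i) (hi2 : i + 1 < n) :
    simple n i * simple n (i + 1) * simple n i =
      simple n (i + 1) * simple n i * simple n (i + 1) := by
  have e2 : simple n (i + 1) = Equiv.swap ⟨i, by omega⟩ ⟨i + 1, hi2⟩ :=
    simple_eq (by omega) hi2
  rw [simple_eq hi1 (by omega), e2]
  have h1 : (⟨i - 1, by omega⟩ : Fin n) ≠ ⟨i, by omega⟩ := by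
    simp only [ne_eq, Fin.mk.injEq]; omega
  have h2 : (⟨i - 1, by omega⟩ : Fin n) ≠ ⟨i + 1, hi2⟩ := by
    simp only [ne_eq, Fin.mk.injEq]; omega
  have h3 : (⟨i, by omega⟩ : Fin n) ≠ ⟨i + 1, hi2⟩ := by
    simp only [ne_eq, Fin.mk.injEq]; omega
  have h4 := Equiv.swap_mul_swap_mul_swap h3.symm h2.symm
  rw [Equiv.swap_comm (⟨i, by omega⟩ : Fin n) ⟨i - 1, by omega⟩,
    Equiv.swap_comm (⟨i + 1, hi2⟩ : Fin n) ⟨i, by omega⟩] at h4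
  rw [Equiv.swap_mul_swap_mul_swap h1 h2, h4, Equiv.swap_comm]

/-- The three ascents that follow from two consecutive ones. -/
theorem isAscent_braid {n i : ℕ} {w : Equiv.Perm (Fin n)} (hi : IsAscent w i)
    (hj : IsAscent w (i + 1)) :
    (IsAscent (w * simple n i) (i + 1) ∧ IsAscent (w * simple n i * simple n (i + 1)) i) ∧
    (IsAscent (w * simple n (i + 1)) i ∧
      IsAscent (w * simple n (i + 1) * simple n i) (i + 1)) := by
  rw [isAscent_iff] at hi hj
  obtain ⟨i1, i2, i3⟩ := hi
  obtain ⟨j1, j2, j3⟩ := hj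
  simp only [Nat.add_sub_cancel] at j3
  have a1 : simple n i ⟨i - 1, by omega⟩ = ⟨i, i2⟩ := by
    rw [simple_eq i1 i2, Equiv.swap_apply_left]
  have a2 : simple n i ⟨i, i2⟩ = ⟨i - 1, by omega⟩ := by
    rw [simple_eq i1 i2, Equiv.swap_apply_right]
  have a3 : simple n i ⟨i + 1, j2⟩ = ⟨i + 1, j2⟩ := by
    rw [simple_eq i1 i2, Equiv.swap_apply_of_ne_of_ne] <;> simp only [ne_eq, Fin.mk.injEq] <;> omega
  have b1 : simple n (i + 1) ⟨i, i2⟩ = ⟨i + 1, j2⟩ := by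
    rw [simple_eq j1 j2]; exact Equiv.swap_apply_left _ _
  have b2 : simple n (i + 1) ⟨i + 1, j2⟩ = ⟨i, i2⟩ := by
    rw [simple_eq j1 j2]; exact Equiv.swap_apply_right _ _
  have b3 : simple n (i + 1) ⟨i - 1, by omega⟩ = ⟨i - 1, by omega⟩ := by
    rw [simple_eq j1 j2, Equiv.swap_apply_of_ne_of_ne] <;> simp only [ne_eq, Fin.mk.injEq] <;> omega
  simp only [isAscent_iff, Nat.add_sub_cancel, Equiv.Perm.mul_apply, a1, a2, a3, b1, b2, b3]
  exact ⟨⟨⟨j1, j2, i3.trans j3⟩, ⟨i1, i2, j3⟩⟩, ⟨⟨i1, i2, i3.trans j3⟩, ⟨j1, j2, i3⟩⟩⟩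

theorem doubleSchubert_rev (n : ℕ) :
    doubleSchubert (Fin.revPerm : Equiv.Perm (Fin n)) = topPoly n := by
  rw [doubleSchubert, if_pos rfl]

/-- The recursion holds for every choice of the simple transposition. -/
theorem doubleSchubert_eq {n : ℕ} (w : Equiv.Perm (Fin n)) (i : ℕ) (hi : IsAscent w i) :
    doubleSchubert w = divDiff i (doubleSchubert (w * simple n i)) := by
  have bound : ∀ v : Equiv.Perm (Fin n), len v ≤ Finset.univ.sup (len (n := n)) := fun v =>
    Finset.le_sup (Finset.mem_univ _)
  induction hd : Finset.univ.sup (len (n := n)) - len w using Nat.strong_induction_on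
    generalizing w i with
  | _ d ih =>
    have step : ∀ v : Equiv.Perm (Fin n), len w < len v → ∀ k, IsAscent v k →
        doubleSchubert v = divDiff k (doubleSchubert (v * simple n k)) := by
      intro v hv k hk
      have := bound v
      exact ih _ (by omega) v k hk rfl
    have far : ∀ i j, IsAscent w i → IsAscent w j → i + 2 ≤ j →
        divDiff i (doubleSchubert (w * simple n i)) =
          divDiff j (doubleSchubert (w * simple n j)) := by
      intro i j hi hj h
      rw [step _ (by have := hi.2.2; omega) j (isAscent_mul_far (Or.inl h) hi hj),
        step _ (by have := hj.2.2; omega) i (isAscent_mul_far (Or.inr h) hj hi),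
        divDiff_comm h, mul_assoc, mul_assoc,
        simple_comm hi.1 hi.2.1 hj.1 hj.2.1 h]
    have near : ∀ i, IsAscent w i → IsAscent w (i + 1) →
        divDiff i (doubleSchubert (w * simple n i)) =
          divDiff (i + 1) (doubleSchubert (w * simple n (i + 1))) := by
      intro i hi hj
      obtain ⟨⟨a1, a2⟩, b1, b2⟩ := isAscent_braid hi hj
      have hi3 := hi.2.2
      have hj3 := hj.2.2
      have a13 := a1.2.2
      have b13 := b1.2.2
      rw [step _ (by omega) _ a1, step _ (by omega) _ a2, step _ (by omega) _ b1,
        step _ (by omega) _ b2, divDiff_braid]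
      have := simple_braid (n := n) hi.1 hj.2.1
      simp only [mul_assoc] at this ⊢
      rw [this]
    have all : ∀ i j, IsAscent w i → IsAscent w j → i ≤ j →
        divDiff i (doubleSchubert (w * simple n i)) =
          divDiff j (doubleSchubert (w * simple n j)) := by
      intro i j hi hj h
      rcases h.eq_or_lt with rfl | h
      · rfl
      rcases (Nat.succ_le_of_lt h).eq_or_lt with h | h
      · subst h; exact near i hi hj
      · exact far i j hi hj h
    have hw : w ≠ Fin.revPerm := by
      rintro rfl
      exact not_isAscent_rev i hi
    have hex : ∃ i, IsAscent w i := ⟨i, hi⟩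
    rw [doubleSchubert, if_neg hw, dif_pos hex]
    rcases le_total hex.choose i with h | h
    · exact all _ _ hex.choose_spec hi h
    · exact (all _ _ hi hex.choose_spec h).symm

/-! ### The block conditions -/

/-- `g_i = v_{n-i} + ⋯ + v_{n-1}`, with `g_0 = 0`. -/
def gSum (n : ℕ) (v : ℕ → ℕ) (i : ℕ) : ℕ := ∑ k ∈ Finset.Ico (n - i) n, v k

/-- `f_i = g_{n-1} + u_1 + ⋯ + u_i`, with `f_0 = g_{n-1}`. -/
def fSum (n : ℕ) (u v : ℕ → ℕ) (i : ℕ) : ℕ := gSum n v (n - 1) + ∑ k ∈ Finset.Icc 1 i, u k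

/-- The letter `e_k` of `e = (e_1, …, e_l)`, for `1 ≤ k ≤ l`. -/
def letter (e : List ℕ) (k : ℕ) : ℕ := e.getD (k - 1) 0

/-- `m ≤ e_{a+1} < e_{a+2} < ⋯ < e_b`; no condition if the block `a + 1, …, b` is empty. -/
def IncBlock (e : List ℕ) (m a b : ℕ) : Prop :=
  (a < b → m ≤ letter e (a + 1)) ∧ ∀ k, a < k → k < b → letter e k < letter e (k + 1)

/-- `e_{a+1} > e_{a+2} > ⋯ > e_b ≥ m`; no condition if the block `a + 1, …, b` is empty. -/
def DecBlock (e : List ℕ) (m a b : ℕ) : Prop :=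
  (∀ k, a < k → k < b → letter e (k + 1) < letter e k) ∧ (a < b → m ≤ letter e b)

/-- The exponent vector of the monomial
`x_1^{u_1} ⋯ x_{n-1}^{u_{n-1}} y_1^{v_1} ⋯ y_{n-1}^{v_{n-1}}`. -/
noncomputable def expVec (n : ℕ) (u v : ℕ → ℕ) : (ℕ ⊕ ℕ) →₀ ℕ :=
  ∑ k ∈ Finset.Ico 1 n, (Finsupp.single (Sum.inl k) (u k) + Finsupp.single (Sum.inr k) (v k))

end DoubleSchubert

namespace DoubleSchubert

/-! ### Products in the nilCoxeter algebra -/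

/-! The approach is that of Fomin and Kirillov: the element 𝔖 = ∑ 𝔖_w w of the nilCoxeter algebra is
an explicit product. With h_i(t) = 1 + t u_i, A_k(t) = h_{n-1}(t) ⋯ h_k(t) and B_k(t) = h_k(t) ⋯
h_{n-1}(t), 𝔖 = B_{n-1}(-y_{n-1}) ⋯ B_1(-y_1) A_1(x_1) ⋯ A_{n-1}(x_{n-1}).

Everything rests on the commutation of A_k(s) with A_k(t) (`decProd_commute`), where the braid
relation enters through `hElem_four`. It has two consequences. Since B_k(-t) is inverse to A_k(t),
the x-factors can be moved through the y-factors, which turns the product into one of ℓ(w_0) factors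
h_a(x_i - y_j) (`yProd_mul_xProd`); its coefficient at w_0 is therefore ∏ (x_i - y_j)
(`schubertMat_rev`). Moreover ∂_i acts on the product as right multiplication by u_i (`xProd_sub`,
`divDiff_schubertMat`). Descending induction on the length then identifies all coefficients
(`doubleSchubert_eq_schubertMat`). The algebra is realised by matrices of right multiplication, and
𝔖_w is the entry at (1, w).

Each variable occurs in a single factor. In A_i(x_i) the power x_i^{u_i} comes with the strictly
decreasing words of length u_i in the letters i, …, n-1; in B_{n-i}(-y_{n-i}) the power of y_{n-i}
comes, up to sign, with the strictly increasing words in the letters n-i, …, n-1. These are the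
blocks of the statement. A concatenation of blocks contributes 1 to the entry at (1, w) if it is a
reduced word for w and 0 otherwise (`wordMat_apply`), and it determines its blocks because their
lengths are prescribed (`HasWordCoeff.mul_listProd`). -/

/-- The defining relations of the nilCoxeter algebra of type `A`. -/
structure NilCoxeterRel {A : Type*} [Ring A] (u : ℕ → A) : Prop where
  sq : ∀ i, u i * u i = 0
  comm : ∀ i j, i + 2 ≤ j → u i * u j = u j * u i
  braid : ∀ i, u i * u (i + 1) * u i = u (i + 1) * u i * u (i + 1)

section NilCoxeter

variable {R A : Type*} [CommRing R] [Ring A] [Algebra R A]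

/-- The element `h_i(t) = 1 + t u_i`. -/
def hElem (u : ℕ → A) (t : R) (i : ℕ) : A := 1 + t • u i

/-- The product `h_{k+m-1}(t) ⋯ h_{k+1}(t) h_k(t)`. -/
def decProd (u : ℕ → A) (t : R) : ℕ → ℕ → A
  | 0, _ => 1
  | m + 1, k => decProd u t m (k + 1) * hElem u t k

/-- The product `h_k(t) h_{k+1}(t) ⋯ h_{k+m-1}(t)`. -/
def incProd (u : ℕ → A) (t : R) : ℕ → ℕ → A
  | 0, _ => 1
  | m + 1, k => hElem u t k * incProd u t m (k + 1)

/-- The product of `decProd u (X (j + r)) (m - r) (k + r)` for `r = 0, …, m - 1`. -/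
def xProd (u : ℕ → A) (X : ℕ → R) : ℕ → ℕ → ℕ → A
  | 0, _, _ => 1
  | m + 1, k, j => decProd u (X j) (m + 1) k * xProd u X m (k + 1) (j + 1)

/-- The product of `incProd u (-Y (j + r)) (m - r) (k + r)` for `r = m - 1, …, 0`. -/
def yProd (u : ℕ → A) (Y : ℕ → R) : ℕ → ℕ → ℕ → A
  | 0, _, _ => 1
  | m + 1, k, j => yProd u Y m (k + 1) (j + 1) * incProd u (-Y j) (m + 1) k

/-- The letters and parameters of the product `h_{k+m-1}(t - Y_{j+m-1}) ⋯ h_k(t - Y_j)`. -/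
def rowList (t : R) (Y : ℕ → R) : ℕ → ℕ → ℕ → List (ℕ × R)
  | 0, _, _ => []
  | m + 1, k, j => rowList t Y m (k + 1) (j + 1) ++ [(k, t - Y j)]

/-- The concatenation of the rows with parameters `X i`, `X (i + 1)`, …, of lengths
`m`, `m - 1`, …, `1`. -/
def triList (X Y : ℕ → R) (j : ℕ) : ℕ → ℕ → ℕ → List (ℕ × R)
  | 0, _, _ => []
  | m + 1, k, i => rowList (X i) Y (m + 1) k j ++ triList X Y j m (k + 1) (i + 1)

/-- The product of the elements `h_a(t)` over a list of pairs `(a, t)`. -/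
def listProd (u : ℕ → A) (L : List (ℕ × R)) : A := (L.map fun p => hElem u p.2 p.1).prod

theorem listProd_append (u : ℕ → A) (L L' : List (ℕ × R)) :
    listProd u (L ++ L') = listProd u L * listProd u L' := by
  simp [listProd]

/-- Truncated subtraction makes this hold at `m = 0` too, where every factor is 1; no case split is
then needed later. -/
theorem xProd_pred (u : ℕ → A) (X : ℕ → R) (m k j : ℕ) :
    xProd u X m k j = decProd u (X j) m k * xProd u X (m - 1) (k + 1) (j + 1) := by
  cases m <;> simp [xProd, decProd]

theorem xProd_congr (u : ℕ → A) {X X' : ℕ → R} (m k j : ℕ) (h : ∀ i, j ≤ i → X i = X' i) :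
    xProd u X m k j = xProd u X' m k j := by
  induction m generalizing k j with
  | zero => rfl
  | succ m ih => simp only [xProd, h j le_rfl, ih (k + 1) (j + 1) fun i hi => h i (by omega)]

/-! ### Identities that follow from the nilCoxeter relations -/

namespace NilCoxeterRel

variable {u : ℕ → A}

theorem commute_hElem_of_commute_gen {a : A} {i : ℕ} (h : Commute (u i) a) (t : R) :
    Commute (hElem u t i) a :=
  (Commute.one_left _).add_left (h.smul_left t)

/-- The cross term vanishes because u_i² = 0. Hence h_i(t) is invertible with inverse h_i(-t). -/
theorem hElem_mul (hu : NilCoxeterRel u) (s t : R) (i : ℕ) :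
    hElem u s i * hElem u t i = hElem u (s + t) i := by
  simp only [hElem, mul_add, add_mul, mul_one, one_mul, smul_mul_smul_comm, hu.sq, smul_zero,
    add_zero, add_smul, add_assoc]

theorem hElem_mul_gen (hu : NilCoxeterRel u) (s : R) (i : ℕ) : hElem u s i * u i = u i := by
  simp [hElem, add_mul, hu.sq]

theorem commute_gen_hElem (hu : NilCoxeterRel u) (t : R) {i j : ℕ} (h : i + 2 ≤ j) :
    Commute (u i) (hElem u t j) :=
  (Commute.one_right _).add_right (Commute.smul_right (hu.comm i j h) t)

theorem commute_gen_decProd (hu : NilCoxeterRel u) (t : R) (m : ℕ) {i k : ℕ} (h : i + 2 ≤ k) :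
    Commute (u i) (decProd u t m k) := by
  induction m generalizing k with
  | zero => exact Commute.one_right _
  | succ m ih => exact (ih (by omega)).mul_right (hu.commute_gen_hElem t h)

theorem commute_gen_incProd (hu : NilCoxeterRel u) (t : R) (m : ℕ) {i k : ℕ} (h : i + 2 ≤ k) :
    Commute (u i) (incProd u t m k) := by
  induction m generalizing k with
  | zero => exact Commute.one_right _
  | succ m ih => exact (hu.commute_gen_hElem t h).mul_right (ih (by omega))

theorem commute_gen_xProd (hu : NilCoxeterRel u) (X : ℕ → R) (m : ℕ) {i k j : ℕ} (h : i + 2 ≤ k) :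
    Commute (u i) (xProd u X m k j) := by
  induction m generalizing k j with
  | zero => exact Commute.one_right _
  | succ m ih => exact (hu.commute_gen_decProd _ _ h).mul_right (ih (by omega))

theorem commute_gen_yProd (hu : NilCoxeterRel u) (Y : ℕ → R) (m : ℕ) {i k j : ℕ} (h : i + 2 ≤ k) :
    Commute (u i) (yProd u Y m k j) := by
  induction m generalizing k j with
  | zero => exact Commute.one_right _
  | succ m ih => exact (ih (by omega)).mul_right (hu.commute_gen_incProd _ _ h)

theorem decProd_mul_incProd (hu : NilCoxeterRel u) (t : R) (m k : ℕ) :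
    decProd u t m k * incProd u (-t) m k = 1 := by
  induction m generalizing k with
  | zero => simp [decProd, incProd]
  | succ m ih =>
    rw [decProd, incProd, mul_assoc, ← mul_assoc (hElem u t k), hu.hElem_mul]
    simp [hElem, ih]

theorem incProd_mul_decProd (hu : NilCoxeterRel u) (t : R) (m k : ℕ) :
    incProd u (-t) m k * decProd u t m k = 1 := by
  induction m generalizing k with
  | zero => simp [decProd, incProd]
  | succ m ih =>
    rw [decProd, incProd, mul_assoc, ← mul_assoc (incProd u _ _ _), ih, one_mul, hu.hElem_mul]
    simp [hElem]

/-- The braid relation cancels the cubic terms. The point is that the right side is symmetric in `s`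
and `t`. -/
theorem hElem_four (hu : NilCoxeterRel u) (s t : R) (k : ℕ) :
    hElem u (-t) (k + 1) * hElem u s k * (hElem u t (k + 1) * hElem u t k) =
      1 + (s + t) • u k + (s * t) • (u k * u (k + 1) - u (k + 1) * u k) := by
  have hb := hu.braid k
  have h1 := hu.sq k
  have h2 := hu.sq (k + 1)
  simp only [hElem]
  generalize u k = b at *
  generalize u (k + 1) = a at *
  have e1 : a * (a * b) = 0 := by rw [← mul_assoc, h2, zero_mul]
  have e2 : a * (a * (b * a)) = 0 := by rw [← mul_assoc, h2, zero_mul]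
  have e3 : b * (a * b) = a * (b * a) := by rw [← mul_assoc, hb, mul_assoc]
  simp only [mul_add, add_mul, mul_one, one_mul, smul_mul_assoc, mul_smul_comm, mul_assoc,
    h1, h2, e1, e2, e3, smul_zero, add_zero, smul_smul, mul_zero, smul_sub, smul_add]
  module

/-- Pulling h_k(s) to the right of A_{k+2}(t) and inserting h_{k+1}(t) h_{k+1}(-t) gives A_k(s)
A_k(t) = A_{k+1}(s) A_{k+1}(t) · E, with E the product of `hElem_four`. The first part is symmetric
by induction, and E is symmetric. Two base cases are needed because A_{k+1}(t) must contain the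
factor h_{k+1}(t). -/
theorem decProd_commute (hu : NilCoxeterRel u) (s t : R) (m k : ℕ) :
    Commute (decProd u s m k) (decProd u t m k) := by
  induction m using Nat.twoStepInduction generalizing k with
  | zero => exact Commute.one_left _
  | one =>
    simp only [Commute, SemiconjBy, decProd, one_mul, hu.hElem_mul, add_comm]
  | more m _ ih =>
    have key : ∀ s t : R, decProd u s (m + 2) k * decProd u t (m + 2) k =
        decProd u s (m + 1) (k + 1) * decProd u t (m + 1) (k + 1) *
          (1 + (s + t) • u k + (s * t) • (u k * u (k + 1) - u (k + 1) * u k)) := by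
      intro s t
      have hc : Commute (hElem u s k) (decProd u t m (k + 1 + 1)) :=
        commute_hElem_of_commute_gen (hu.commute_gen_decProd t m (by omega)) s
      have hi : hElem u t (k + 1) * hElem u (-t) (k + 1) = 1 := by
        rw [hu.hElem_mul]; simp [hElem]
      have d1 : ∀ s : R, decProd u s (m + 2) k = decProd u s (m + 1) (k + 1) * hElem u s k :=
        fun _ => rfl
      have d2 : decProd u t (m + 1) (k + 1) = decProd u t m (k + 1 + 1) * hElem u t (k + 1) := rfl
      rw [← hu.hElem_four, d1, d1, d2]
      calc _ = decProd u s (m + 1) (k + 1) * (hElem u s k * decProd u t m (k + 1 + 1)) *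
            (hElem u t (k + 1) * hElem u t k) := by simp only [mul_assoc]
        _ = decProd u s (m + 1) (k + 1) * decProd u t m (k + 1 + 1) *
            (hElem u t (k + 1) * hElem u (-t) (k + 1)) * hElem u s k *
            (hElem u t (k + 1) * hElem u t k) := by
          rw [hc.eq, hi, mul_one]; simp only [mul_assoc]
        _ = _ := by simp only [mul_assoc]
    rw [Commute, SemiconjBy, key s t, key t s, (ih (k + 1)).eq, add_comm s t, mul_comm s t]

/-- As the inverse of a product that commutes with the x-factor, the y-factor commutes with it too.
After the exchange h_k(s) and h_k(-t) are adjacent and merge; this is the source of the differences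
x_i - y_j. -/
theorem incProd_mul_decProd_succ (hu : NilCoxeterRel u) (s t : R) (m k : ℕ) :
    incProd u (-t) (m + 1) k * decProd u s (m + 1) k =
      decProd u s m (k + 1) * hElem u (s - t) k * incProd u (-t) m (k + 1) := by
  have h := (hu.decProd_commute s t (m + 1) k).eq
  calc _ = incProd u (-t) (m + 1) k * (decProd u s (m + 1) k * decProd u t (m + 1) k) *
        incProd u (-t) (m + 1) k := by
        rw [mul_assoc, mul_assoc (decProd u s _ _), hu.decProd_mul_incProd, mul_one]
    _ = decProd u s (m + 1) k * incProd u (-t) (m + 1) k := by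
        rw [h, ← mul_assoc, hu.incProd_mul_decProd, one_mul]
    _ = _ := by
        rw [decProd, incProd, sub_eq_add_neg, ← hu.hElem_mul]
        simp only [mul_assoc]

/-- One x-factor travels leftwards through all y-factors. At each passage it leaves a single h
behind, and the y-factor loses its lowest generator. -/
theorem yProd_mul_decProd (hu : NilCoxeterRel u) (Y : ℕ → R) (t : R) (m k j : ℕ) :
    yProd u Y m k j * decProd u t m k =
      listProd u (rowList t Y m k j) * yProd u Y (m - 1) (k + 1) j := by
  induction m generalizing k j with
  | zero => simp [yProd, decProd, rowList, listProd]
  | succ m ih =>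
    have hc : Commute (hElem u (t - Y j) k) (yProd u Y (m - 1) (k + 1 + 1) (j + 1)) :=
      commute_hElem_of_commute_gen (hu.commute_gen_yProd Y _ (by omega)) _
    -- The shortened y-factor becomes the last factor of the y-product that starts one generator
    -- higher.
    have hr : yProd u Y (m - 1) (k + 1 + 1) (j + 1) * incProd u (-Y j) m (k + 1) =
        yProd u Y m (k + 1) j := by
      cases m <;> simp [yProd, incProd]
    rw [yProd, mul_assoc, hu.incProd_mul_decProd_succ, rowList, listProd_append, ← mul_assoc,
      ← mul_assoc, ih, mul_assoc _ _ (hElem _ _ _), ← hc.eq, Nat.add_sub_cancel, ← hr]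
    simp only [listProd, List.map_cons, List.map_nil, List.prod_cons, List.prod_nil, mul_one,
      mul_assoc]

/-- The factorization of the generating element of the double Schubert polynomials. -/
theorem yProd_mul_xProd (hu : NilCoxeterRel u) (X Y : ℕ → R) (m k i j : ℕ) :
    yProd u Y m k j * xProd u X m k i = listProd u (triList X Y j m k i) := by
  induction m generalizing k i with
  | zero => simp [yProd, xProd, triList, listProd]
  | succ m ih =>
    rw [xProd, ← mul_assoc, hu.yProd_mul_decProd, mul_assoc, Nat.add_sub_cancel, ih, triList,
      listProd_append]

/-- Since A_{k+1}(s) = A_k(s) h_k(-s), both terms are the symmetric product A_k(s) A_k(t) times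
h_k(-t) or h_k(-s), and these differ by (s - t) u_k. The identity h_k(-t) u_k = u_k restores the
shape of the right side. -/
theorem decProd_mul_decProd_sub (hu : NilCoxeterRel u) (s t : R) (m k : ℕ) :
    decProd u s (m + 1) k * decProd u t m (k + 1) - decProd u t (m + 1) k * decProd u s m (k + 1)
      = (s - t) • (decProd u s (m + 1) k * decProd u t m (k + 1) * u k) := by
  have h := (hu.decProd_commute s t (m + 1) k).eq
  have e : ∀ s : R, decProd u s m (k + 1) = decProd u s (m + 1) k * hElem u (-s) k := by
    intro s
    rw [decProd, mul_assoc, hu.hElem_mul]; simp [hElem]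
  rw [e t, e s, ← mul_assoc, ← mul_assoc, ← h, mul_assoc _ _ (u k), hu.hElem_mul_gen,
    ← mul_sub, ← mul_smul_comm]
  congr 1
  simp only [hElem]
  module

/-- Only two adjacent factors involve the exchanged parameters. All later factors use generators of
index at least k + r + 2, so u_{k+r} passes through them to the right end. -/
theorem xProd_sub (hu : NilCoxeterRel u) (X : ℕ → R) (m k j r : ℕ) (hr : r < m) :
    xProd u X m k j - xProd u (X ∘ Equiv.swap (j + r) (j + r + 1)) m k j =
      (X (j + r) - X (j + r + 1)) • (xProd u X m k j * u (k + r)) := by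
  induction r generalizing m k j with
  | zero =>
    obtain ⟨m, rfl⟩ : ∃ l, m = l + 1 := ⟨m - 1, by omega⟩
    rw [xProd, xProd, xProd_pred, xProd_pred u (X ∘ _),
      xProd_congr u (X := X ∘ _) (X' := X) (m - 1)]
    · simp only [add_zero, Function.comp, Equiv.swap_apply_left, Equiv.swap_apply_right]
      have hc : Commute (u k) (xProd u X (m - 1) (k + 1 + 1) (j + 1 + 1)) :=
        hu.commute_gen_xProd X _ (by omega)
      rw [← mul_assoc, ← mul_assoc, ← sub_mul, hu.decProd_mul_decProd_sub, smul_mul_assoc,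
        mul_assoc _ (u k), hc.eq, mul_assoc _ _ (u k)]
    · intro i hi
      simp only [Function.comp]
      rw [Equiv.swap_apply_of_ne_of_ne] <;> omega
  | succ r ih =>
    obtain ⟨m, rfl⟩ : ∃ l, m = l + 1 := ⟨m - 1, by omega⟩
    have e : (X ∘ Equiv.swap (j + (r + 1)) (j + (r + 1) + 1)) j = X j := by
      simp only [Function.comp]
      rw [Equiv.swap_apply_of_ne_of_ne] <;> omega
    have := ih m (k + 1) (j + 1) (by omega)
    rw [show j + 1 + r = j + (r + 1) by omega, show k + 1 + r = k + (r + 1) by omega] at this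
    rw [xProd, xProd, e, ← mul_sub, this, mul_smul_comm, mul_assoc]

end NilCoxeterRel

end NilCoxeter

/-! ### The regular representation of the nilCoxeter algebra -/

section Representation

open Classical in
/-- The matrix of the right multiplication by `u_i` on the nilCoxeter algebra of `S_n`. -/
noncomputable def genMat (n : ℕ) (R : Type*) [CommRing R] (i : ℕ) :
    Matrix (Equiv.Perm (Fin n)) (Equiv.Perm (Fin n)) R :=
  Matrix.of fun v w => if IsAscent v i ∧ w = v * simple n i then 1 else 0

/-- The matrix of the right multiplication by `u_{e_1} ⋯ u_{e_l}`. -/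
noncomputable def wordMat (n : ℕ) (R : Type*) [CommRing R] (e : List ℕ) :
    Matrix (Equiv.Perm (Fin n)) (Equiv.Perm (Fin n)) R :=
  (e.map (genMat n R)).prod

variable {n : ℕ} {R : Type*} [CommRing R]

theorem wordMat_append (e e' : List ℕ) :
    wordMat n R (e ++ e') = wordMat n R e * wordMat n R e' := by
  simp [wordMat]

open Classical in
theorem genMat_mul_apply (i : ℕ) (M : Matrix (Equiv.Perm (Fin n)) (Equiv.Perm (Fin n)) R)
    (v w : Equiv.Perm (Fin n)) :
    (genMat n R i * M) v w = if IsAscent v i then M (v * simple n i) w else 0 := by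
  rw [Matrix.mul_apply]
  by_cases h : IsAscent v i <;> simp [genMat, h]

/-- Reads the coefficient at w off the product with u_i; with ∂_i acting as u_i, it gives the
recursion for 𝔖_w. -/
theorem mul_genMat_apply (M : Matrix (Equiv.Perm (Fin n)) (Equiv.Perm (Fin n)) R)
    (v : Equiv.Perm (Fin n)) {w : Equiv.Perm (Fin n)} {i : ℕ} (h : IsAscent w i) :
    (M * genMat n R i) v (w * simple n i) = M v w := by
  rw [Matrix.mul_apply, Finset.sum_eq_single w]
  · simp [genMat, h]
  · intro b _ hb
    simp [genMat, hb.symm]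
  · simp

theorem len_mul_simple_le (v : Equiv.Perm (Fin n)) {i : ℕ} (h1 : 1 ≤ i) (h2 : i < n) :
    len (v * simple n i) ≤ len v + 1 := by
  rw [len_eq, len_eq]
  exact card_invSet_le v h1 h2

theorem len_mul_word_le (v : Equiv.Perm (Fin n)) (e : List ℕ) (he : ∀ a ∈ e, 1 ≤ a ∧ a < n) :
    len (v * (e.map (simple n)).prod) ≤ len v + e.length := by
  induction e generalizing v with
  | nil => simp
  | cons a e ih =>
    have ha := he a (by simp)
    have h1 := ih (v * simple n a) fun b hb => he b (by simp [hb])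
    have h2 := len_mul_simple_le v ha.1 ha.2
    simp only [List.map_cons, List.prod_cons, List.length_cons, ← mul_assoc]
    omega

open Classical in
-- A product of generators survives exactly when every letter raises the length by one, which the
-- total length detects. For `v = 1` this is the indicator of the reduced words for `w`.
theorem wordMat_apply (e : List ℕ) (v w : Equiv.Perm (Fin n)) :
    wordMat n R e v w = if (∀ a ∈ e, 1 ≤ a ∧ a < n) ∧ v * (e.map (simple n)).prod = w ∧
      len w = len v + e.length then 1 else 0 := by
  induction e generalizing v with
  | nil =>
    by_cases h : v = w
    · simp [wordMat, h]
    · simp [wordMat, h]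
  | cons a e ih =>
    have : wordMat n R (a :: e) = genMat n R a * wordMat n R e := by simp [wordMat]
    rw [this, genMat_mul_apply, ih]
    by_cases ha : IsAscent v a
    · have := ha.2.2
      simp only [ha, if_true, List.mem_cons, forall_eq_or_imp, ha.1, ha.2.1, true_and, and_self,
        List.map_cons, List.prod_cons, mul_assoc, List.length_cons, this]
      congr 4
      omega
    · rw [if_neg ha, if_neg]
      -- A letter adds at most one to the length, so a loss at the first letter could not be made up
      -- later.
      rintro ⟨h1, h2, h3⟩
      apply ha
      have hb := h1 a (by simp)
      refine ⟨hb.1, hb.2, le_antisymm (len_mul_simple_le v hb.1 hb.2) ?_⟩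
      have := len_mul_word_le (v * simple n a) e fun b hb => h1 b (by simp [hb])
      simp only [List.map_cons, List.prod_cons, ← mul_assoc, List.length_cons] at h2 h3
      rw [h2] at this
      omega

/-- Reduces the nilCoxeter relations to the relations of the symmetric group; words with letters out
of range give 0 on both sides. -/
theorem wordMat_congr {e e' : List ℕ} (hl : e.length = e'.length)
    (hm : (∀ a ∈ e, 1 ≤ a ∧ a < n) ↔ ∀ a ∈ e', 1 ≤ a ∧ a < n)
    (hp : (∀ a ∈ e, 1 ≤ a ∧ a < n) → (e.map (simple n)).prod = (e'.map (simple n)).prod) :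
    wordMat n R e = wordMat n R e' := by
  ext v w
  rw [wordMat_apply, wordMat_apply]
  by_cases h : ∀ a ∈ e, 1 ≤ a ∧ a < n
  · simp only [hl, hp h, hm]
  · rw [if_neg fun h' => h h'.1, if_neg fun h' => h (hm.2 h'.1)]

variable (n R) in
theorem nilCoxeterRel_genMat : NilCoxeterRel (genMat n R) where
  sq i := by
    have h : wordMat n R [i, i] = 0 := by
      ext v w
      rw [wordMat_apply, if_neg, Matrix.zero_apply]
      rintro ⟨-, h1, h2⟩
      simp only [List.map_cons, List.map_nil, List.prod_cons, List.prod_nil, mul_one,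
        simple_mul_self, List.length_cons, List.length_nil] at h1 h2
      rw [h1] at h2
      omega
    simpa [wordMat] using h
  comm i j hij := by
    have h : wordMat n R [i, j] = wordMat n R [j, i] := by
      refine wordMat_congr (by rfl) ?_ ?_
      · simp [and_comm]
      · intro h
        have hi := h i (by simp)
        have hj := h j (by simp)
        simpa using simple_comm hi.1 hi.2 hj.1 hj.2 hij
    simpa [wordMat] using h
  braid i := by
    have h : wordMat n R [i, i + 1, i] = wordMat n R [i + 1, i, i + 1] := by
      refine wordMat_congr (by rfl) ?_ ?_
      · simp only [List.mem_cons, List.not_mem_nil, or_false, forall_eq_or_imp, forall_eq]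
        tauto
      · intro h
        have hi := h i (by simp)
        have hj := h (i + 1) (by simp)
        simpa [mul_assoc] using simple_braid hi.1 hj.2
    simpa [wordMat, mul_assoc] using h

/-- The entries of a product of elements `h_a(t)` in top degree. -/
theorem listProd_apply (L : List (ℕ × R)) (v w : Equiv.Perm (Fin n)) :
    (len v + L.length < len w → listProd (genMat n R) L v w = 0) ∧
    (len w = len v + L.length → listProd (genMat n R) L v w =
      (L.map Prod.snd).prod * wordMat n R (L.map Prod.fst) v w) := by
  induction L generalizing v with
  | nil =>
    refine ⟨fun h => ?_, fun _ => by simp [listProd, wordMat]⟩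
    have : v ≠ w := by
      rintro rfl
      simp at h
    simp [listProd, this]
  | cons p L ih =>
    have e : listProd (genMat n R) (p :: L) = listProd (genMat n R) L +
        p.2 • (genMat n R p.1 * listProd (genMat n R) L) := by
      simp [listProd, hElem, add_mul]
    have e2 : wordMat n R ((p :: L).map Prod.fst) =
        genMat n R p.1 * wordMat n R (L.map Prod.fst) := by simp [wordMat]
    rw [e, e2, Matrix.add_apply, Matrix.smul_apply, genMat_mul_apply, genMat_mul_apply]
    simp only [List.length_cons, List.map_cons, List.prod_cons, smul_eq_mul]
    constructor
    · intro h
      rw [(ih v).1 (by omega), zero_add]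
      split_ifs with ha
      · rw [(ih _).1 (by have := ha.2.2; omega), mul_zero]
      · rw [mul_zero]
    · intro h
      -- Choosing 1 in the first factor leaves too few letters to reach the length of `w`.
      rw [(ih v).1 (by omega), zero_add]
      split_ifs with ha
      · rw [(ih _).2 (by have := ha.2.2; omega), mul_assoc]
      · rw [mul_zero, mul_zero]

end Representation

/-! ### The double Schubert polynomials as entries of a product -/

theorem rowList_length {R : Type*} [CommRing R] (t : R) (Y : ℕ → R) (m k j : ℕ) :
    (rowList t Y m k j).length = m := by
  induction m generalizing k j with
  | zero => rfl
  | succ m ih => simp [rowList, ih]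

theorem triList_length {R : Type*} [CommRing R] (X Y : ℕ → R) (j m k i : ℕ) :
    (triList X Y j m k i).length = ∑ r ∈ Finset.range (m + 1), r := by
  induction m generalizing k i with
  | zero => rfl
  | succ m ih =>
    rw [triList, List.length_append, rowList_length, ih, Finset.sum_range_succ _ (m + 1), add_comm]

theorem rowList_prod_snd {R : Type*} [CommRing R] (t : R) (Y : ℕ → R) (m k j : ℕ) :
    ((rowList t Y m k j).map Prod.snd).prod = ∏ r ∈ Finset.range m, (t - Y (j + r)) := by
  induction m generalizing k j with
  | zero => simp [rowList]
  | succ m ih =>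
    rw [rowList, List.map_append, List.prod_append, ih, Finset.prod_range_succ']
    simp [add_comm, add_left_comm]

theorem triList_prod_snd {R : Type*} [CommRing R] (X Y : ℕ → R) (j m k i : ℕ) :
    ((triList X Y j m k i).map Prod.snd).prod =
      ∏ s ∈ Finset.range m, ∏ r ∈ Finset.range (m - s), (X (i + s) - Y (j + r)) := by
  induction m generalizing k i with
  | zero => simp [triList]
  | succ m ih =>
    rw [triList, List.map_append, List.prod_append, ih, Finset.prod_range_succ', rowList_prod_snd,
      mul_comm]
    congr 1
    refine Finset.prod_congr rfl fun s _ => ?_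
    rw [show m + 1 - (s + 1) = m - s by omega, show i + 1 + s = i + (s + 1) by omega]

theorem topPoly_eq (n : ℕ) : topPoly n =
    ∏ s ∈ Finset.range (n - 1), ∏ r ∈ Finset.range (n - 1 - s), (x (1 + s) - y (1 + r)) := by
  rw [topPoly, Finset.prod_sigma']
  refine Finset.prod_bij' (fun p _ => ⟨p.1 - 1, p.2 - 1⟩) (fun p _ => (1 + p.1, 1 + p.2))
    ?_ ?_ ?_ ?_ ?_
  · rintro ⟨a, b⟩ h
    simp only [Finset.mem_filter, Finset.mem_product, Finset.mem_Icc, Finset.mem_sigma,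
      Finset.mem_range] at h ⊢
    omega
  · rintro ⟨a, b⟩ h
    simp only [Finset.mem_filter, Finset.mem_product, Finset.mem_Icc, Finset.mem_sigma,
      Finset.mem_range] at h ⊢
    omega
  · rintro ⟨a, b⟩ h
    simp only [Finset.mem_filter, Finset.mem_product, Finset.mem_Icc] at h
    simp only [Prod.mk.injEq]
    omega
  · rintro ⟨a, b⟩ h
    simp
  · rintro ⟨a, b⟩ h
    simp only [Finset.mem_filter, Finset.mem_product, Finset.mem_Icc] at h
    simp only
    rw [show 1 + (a - 1) = a by omega, show 1 + (b - 1) = b by omega]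

/-- `s_{k+m-1} ⋯ s_k` is a cycle. -/
theorem rowList_prod_simple {R : Type*} [CommRing R] {n : ℕ} (t : R) (Y : ℕ → R) (m k j : ℕ)
    (hk : 1 ≤ k) (hn : k + m = n) (c : Fin n) :
    (((((rowList t Y m k j).map Prod.fst).map (simple n)).prod c : Fin n) : ℕ) =
      if c.val + 1 = k then n - 1 else if c.val + 1 < k then c.val else c.val - 1 := by
  induction m generalizing k j c with
  | zero =>
    have := c.2
    simp only [rowList, List.map_nil, List.prod_nil, Equiv.Perm.one_apply]
    split_ifs <;> omega
  | succ m ih =>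
    simp only [rowList, List.map_append, List.prod_append, List.map_cons, List.map_nil,
      List.prod_cons, List.prod_nil, mul_one, Equiv.Perm.mul_apply]
    have := c.2
    rw [ih _ _ (by omega) (by omega), simple_eq hk (by omega), Equiv.swap_apply_def]
    simp only [Fin.ext_iff]
    split_ifs <;> first | omega | (simp only at *; omega) | simp at *

/-- By induction the later rows reverse the positions from `k` on (counted from 0); the cycle of the
first row sends k - 1 to the end and shifts the others down. At `k = 1` the result is w_0. -/
theorem triList_prod_simple {R : Type*} [CommRing R] {n : ℕ} (X Y : ℕ → R) (j m k i : ℕ)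
    (hk : 1 ≤ k) (hn : k + m = n) (c : Fin n) :
    (((((triList X Y j m k i).map Prod.fst).map (simple n)).prod c : Fin n) : ℕ) =
      if c.val + 1 < k then c.val else n + k - 2 - c.val := by
  induction m generalizing k i c with
  | zero =>
    have := c.2
    simp only [triList, List.map_nil, List.prod_nil, Equiv.Perm.one_apply]
    split_ifs <;> omega
  | succ m ih =>
    have := c.2
    simp only [triList, List.map_append, List.prod_append, Equiv.Perm.mul_apply]
    rw [rowList_prod_simple _ _ _ _ _ hk hn, ih _ _ (by omega) (by omega)]
    split_ifs <;> omega

theorem letters_triList {R : Type*} [CommRing R] (X Y : ℕ → R) (j m k i : ℕ) :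
    ∀ a ∈ (triList X Y j m k i).map Prod.fst, k ≤ a ∧ a < k + m := by
  have row : ∀ (t : R) m k j, ∀ a ∈ (rowList t Y m k j).map Prod.fst, k ≤ a ∧ a < k + m := by
    intro t m
    induction m with
    | zero => simp [rowList]
    | succ m ih =>
      intro k j a ha
      rw [rowList, List.map_append, List.mem_append] at ha
      rcases ha with ha | ha
      · have := ih _ _ a ha
        omega
      · simp only [List.map_cons, List.map_nil, List.mem_singleton] at ha
        omega
  induction m generalizing k i with
  | zero => simp [triList]
  | succ m ih =>
    intro a ha
    rw [triList, List.map_append, List.mem_append] at ha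
    rcases ha with ha | ha
    · exact row _ _ _ _ a ha
    · have := ih _ _ a ha
      omega

theorem len_one (n : ℕ) : len (1 : Equiv.Perm (Fin n)) = 0 := by
  rw [len_eq, card_invSet_one]

theorem len_revPerm (n : ℕ) :
    len (Fin.revPerm : Equiv.Perm (Fin n)) = ∑ r ∈ Finset.range n, r := by
  have h : invSet (Fin.revPerm : Equiv.Perm (Fin n)) =
      ((Finset.univ : Finset (Fin n)).sigma fun a => Finset.Ioi a).map
        (Equiv.sigmaEquivProd (Fin n) (Fin n)).toEmbedding := by
    ext ⟨a, b⟩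
    simp [mem_invSet]
  rw [len_eq, h, Finset.card_map, Finset.card_sigma, ← Finset.sum_range_reflect,
    ← Fin.sum_univ_eq_sum_range (fun r => n - 1 - r)]
  simp [Fin.card_Ioi]

/-- The generating element `∑ 𝔖_w(X; Y) w` of the nilCoxeter algebra, as a matrix. -/
noncomputable def schubertMat (n : ℕ) (X Y : ℕ → Poly) :
    Matrix (Equiv.Perm (Fin n)) (Equiv.Perm (Fin n)) Poly :=
  yProd (genMat n Poly) Y (n - 1) 1 1 * xProd (genMat n Poly) X (n - 1) 1 1

/-- The factored form has exactly ℓ(w_0) factors, so only the full word reaches w_0, with the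
product of all parameters as its coefficient. -/
theorem schubertMat_rev (n : ℕ) : schubertMat n x y 1 Fin.revPerm = topPoly n := by
  classical
  have hp : ((((triList x y 1 (n - 1) 1 1).map Prod.fst).map (simple n)).prod) = Fin.revPerm := by
    ext c
    have := c.2
    rw [triList_prod_simple _ _ _ _ _ _ le_rfl (by omega), Fin.revPerm_apply, Fin.val_rev,
      if_neg (by omega)]
    omega
  have hl : len (Fin.revPerm : Equiv.Perm (Fin n)) = len (1 : Equiv.Perm (Fin n)) +
      (triList x y 1 (n - 1) 1 1).length := by
    rw [len_one, zero_add, len_revPerm, triList_length]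
    cases n <;> simp
  rw [schubertMat, (nilCoxeterRel_genMat n Poly).yProd_mul_xProd, (listProd_apply _ _ _).2 hl,
    triList_prod_snd, topPoly_eq, wordMat_apply, if_pos, mul_one]
  refine ⟨fun a ha => ?_, by rw [one_mul, hp], by rw [hl, List.length_map]⟩
  have := letters_triList _ _ _ _ _ _ a ha
  omega

/-! ### Change of coefficients, and divided differences as multiplication by generators -/

theorem genMat_map {R S : Type*} [CommRing R] [CommRing S] (n : ℕ) (φ : R →+* S) (i : ℕ) :
    φ.mapMatrix (genMat n R i) = genMat n S i := by
  ext v w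
  simp only [genMat, RingHom.mapMatrix_apply, Matrix.map_apply, Matrix.of_apply]
  split_ifs <;> simp

theorem map_hElem {R S : Type*} [CommRing R] [CommRing S] (n : ℕ) (φ : R →+* S) (t : R) (i : ℕ) :
    φ.mapMatrix (hElem (genMat n R) t i) = hElem (genMat n S) (φ t) i := by
  rw [hElem, hElem, map_add, map_one, ← genMat_map n φ]
  congr 1
  ext v w
  simp

theorem map_decProd {R S : Type*} [CommRing R] [CommRing S] (n : ℕ) (φ : R →+* S) (t : R)
    (m k : ℕ) : φ.mapMatrix (decProd (genMat n R) t m k) = decProd (genMat n S) (φ t) m k := by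
  induction m generalizing k with
  | zero => exact map_one _
  | succ m ih => rw [decProd, decProd, map_mul, ih, map_hElem]

theorem map_incProd {R S : Type*} [CommRing R] [CommRing S] (n : ℕ) (φ : R →+* S) (t : R)
    (m k : ℕ) : φ.mapMatrix (incProd (genMat n R) t m k) = incProd (genMat n S) (φ t) m k := by
  induction m generalizing k with
  | zero => exact map_one _
  | succ m ih => rw [incProd, incProd, map_mul, ih, map_hElem]

theorem map_xProd {R S : Type*} [CommRing R] [CommRing S] (n : ℕ) (φ : R →+* S) (X : ℕ → R)
    (m k j : ℕ) : φ.mapMatrix (xProd (genMat n R) X m k j) = xProd (genMat n S) (φ ∘ X) m k j := by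
  induction m generalizing k j with
  | zero => exact map_one _
  | succ m ih => rw [xProd, xProd, map_mul, ih, map_decProd, Function.comp]

theorem map_yProd {R S : Type*} [CommRing R] [CommRing S] (n : ℕ) (φ : R →+* S) (Y : ℕ → R)
    (m k j : ℕ) : φ.mapMatrix (yProd (genMat n R) Y m k j) = yProd (genMat n S) (φ ∘ Y) m k j := by
  induction m generalizing k j with
  | zero => exact map_one _
  | succ m ih => rw [yProd, yProd, map_mul, ih, map_incProd, map_neg, Function.comp]

theorem exch_comp_x (i : ℕ) : exch i ∘ x = x ∘ Equiv.swap i (i + 1) := by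
  funext j
  simp only [Function.comp, exch_x, Equiv.swap_apply_def]
  split_ifs <;> rfl

theorem exch_comp_y (i : ℕ) : exch i ∘ y = y := by
  funext j
  simp [exch, y, Equiv.swap_apply_def]

/-- The exchange of x_i and x_{i+1} fixes the y-product, so `xProd_sub` multiplied on the left by it
gives the claim after cancelling x_i - x_{i+1}. -/
theorem divDiff_schubertMat {n i : ℕ} (h1 : 1 ≤ i) (h2 : i < n) (v w : Equiv.Perm (Fin n)) :
    divDiff i (schubertMat n x y v w) = (schubertMat n x y * genMat n Poly i) v w := by
  apply mul_left_cancel₀ (x_sub_ne (show i ≠ i + 1 by omega))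
  have hs := (nilCoxeterRel_genMat n Poly).xProd_sub x (n - 1) 1 1 (i - 1) (by omega)
  rw [show 1 + (i - 1) = i by omega] at hs
  have he : (exch i).toRingHom.mapMatrix (schubertMat n x y) =
      yProd (genMat n Poly) y (n - 1) 1 1 *
        xProd (genMat n Poly) (x ∘ Equiv.swap i (i + 1)) (n - 1) 1 1 := by
    have hx : (exch i).toRingHom ∘ x = x ∘ Equiv.swap i (i + 1) := exch_comp_x i
    have hy : (exch i).toRingHom ∘ y = y := exch_comp_y i
    rw [schubertMat, map_mul, map_xProd, map_yProd, hx, hy]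
  have hm := congrArg (fun M => (yProd (genMat n Poly) y (n - 1) 1 1 * M) v w) hs
  simp only [mul_sub, mul_smul_comm, ← he, ← mul_assoc] at hm
  rw [← schubertMat, Matrix.sub_apply, Matrix.smul_apply] at hm
  rw [divDiff_spec]
  exact hm

/-- The double Schubert polynomials are the entries of the first row of `schubertMat`. -/
theorem doubleSchubert_eq_schubertMat {n : ℕ} (w : Equiv.Perm (Fin n)) :
    doubleSchubert w = schubertMat n x y 1 w := by
  have bound : ∀ v : Equiv.Perm (Fin n), len v ≤ Finset.univ.sup (len (n := n)) := fun v =>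
    Finset.le_sup (Finset.mem_univ _)
  induction hd : Finset.univ.sup (len (n := n)) - len w using Nat.strong_induction_on
    generalizing w with
  | _ d ih =>
    by_cases hw : w = Fin.revPerm
    · rw [hw, doubleSchubert_rev, schubertMat_rev]
    · obtain ⟨i, hi⟩ := exists_isAscent w hw
      have := bound (w * simple n i)
      have := hi.2.2
      -- 𝔖_w = ∂_i 𝔖_{w s_i} is the entry of 𝔖 u_i at w s_i, which is the entry of 𝔖 at w.
      rw [doubleSchubert_eq w i hi, ih _ (by omega) _ rfl, divDiff_schubertMat hi.1 hi.2.1,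
        mul_genMat_apply _ _ hi]

/-! ### The block conditions and concatenation -/

theorem letter_append_left {e l : List ℕ} {k : ℕ} (h1 : 1 ≤ k) (h2 : k ≤ e.length) :
    letter (e ++ l) k = letter e k :=
  List.getD_append _ _ _ _ (by omega)

theorem letter_append_right (e l : List ℕ) {k : ℕ} (h : 1 ≤ k) :
    letter (e ++ l) (e.length + k) = letter l k := by
  rw [letter, letter, List.getD_append_right _ _ _ _ (by omega)]
  congr 1
  omega

theorem incBlock_append_left {e l : List ℕ} (m a : ℕ) {b : ℕ} (hb : b ≤ e.length) :
    IncBlock (e ++ l) m a b ↔ IncBlock e m a b := by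
  refine and_congr (forall_congr' fun h => ?_)
    (forall_congr' fun k => forall_congr' fun h1 => forall_congr' fun h2 => ?_)
  · rw [letter_append_left (by omega) (by omega)]
  · rw [letter_append_left (by omega) (by omega), letter_append_left (by omega) (by omega)]

theorem decBlock_append_left {e l : List ℕ} (m a : ℕ) {b : ℕ} (hb : b ≤ e.length) :
    DecBlock (e ++ l) m a b ↔ DecBlock e m a b := by
  refine and_congr (forall_congr' fun k => forall_congr' fun h1 => forall_congr' fun h2 => ?_)
    (forall_congr' fun h => ?_)
  · rw [letter_append_left (by omega) (by omega), letter_append_left (by omega) (by omega)]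
  · rw [letter_append_left (by omega) (by omega)]

theorem letter_succ {l : List ℕ} {k : ℕ} (h : k < l.length) : letter l (k + 1) = l[k] := by
  simp [letter, h]

/-- Bounding the first letter of an increasing block bounds all of them, so the condition depends on
the block alone. -/
theorem incBlock_append_right (e l : List ℕ) (m : ℕ) :
    IncBlock (e ++ l) m e.length (e.length + l.length) ↔
      l.Pairwise (· < ·) ∧ ∀ a ∈ l, m ≤ a := by
  have hs : ∀ k, letter (e ++ l) (e.length + k + 1) = letter l (k + 1) := fun k => by
    rw [add_assoc, letter_append_right _ _ (by omega)]
  have hc : (∀ k, e.length < k → k < e.length + l.length →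
      letter (e ++ l) k < letter (e ++ l) (k + 1)) ↔ l.Pairwise (· < ·) := by
    rw [← List.isChain_iff_pairwise, List.isChain_iff_getElem]
    constructor
    · intro h i hi
      have := h (e.length + i + 1) (by omega) (by omega)
      rwa [hs, show e.length + i + 1 + 1 = e.length + (i + 1) + 1 by omega, hs,
        letter_succ (by omega), letter_succ hi] at this
    · intro h k h1 h2
      obtain ⟨i, rfl⟩ : ∃ i, k = e.length + i + 1 := ⟨k - e.length - 1, by omega⟩
      rw [hs, show e.length + i + 1 + 1 = e.length + (i + 1) + 1 by omega, hs,
        letter_succ (by omega), letter_succ (by omega)]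
      exact h i (by omega)
  rw [IncBlock, hc, and_comm]
  refine and_congr_right fun hp => ?_
  rcases l with _ | ⟨b, l⟩
  · simp
  · have hb : letter (e ++ b :: l) (e.length + 1) = b := by
      have := hs 0
      rwa [letter_succ (l := b :: l) (by simp)] at this
    rw [hb]
    constructor
    · intro h a ha
      have hm := h (by simp)
      rcases List.mem_cons.1 ha with rfl | ha
      · exact hm
      · exact hm.trans (List.rel_of_pairwise_cons hp ha).le
    · intro h _
      exact h b (by simp)

theorem decBlock_append_right (e l : List ℕ) (m : ℕ) :
    DecBlock (e ++ l) m e.length (e.length + l.length) ↔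
      l.Pairwise (· > ·) ∧ ∀ a ∈ l, m ≤ a := by
  have hs : ∀ k, letter (e ++ l) (e.length + k + 1) = letter l (k + 1) := fun k => by
    rw [add_assoc, letter_append_right _ _ (by omega)]
  have hc : (∀ k, e.length < k → k < e.length + l.length →
      letter (e ++ l) (k + 1) < letter (e ++ l) k) ↔ l.Pairwise (· > ·) := by
    rw [← List.isChain_iff_pairwise, List.isChain_iff_getElem]
    constructor
    · intro h i hi
      have := h (e.length + i + 1) (by omega) (by omega)
      rwa [hs, show e.length + i + 1 + 1 = e.length + (i + 1) + 1 by omega, hs,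
        letter_succ hi, letter_succ (by omega)] at this
    · intro h k h1 h2
      obtain ⟨i, rfl⟩ : ∃ i, k = e.length + i + 1 := ⟨k - e.length - 1, by omega⟩
      rw [hs, show e.length + i + 1 + 1 = e.length + (i + 1) + 1 by omega, hs,
        letter_succ (by omega), letter_succ (by omega)]
      exact h i (by omega)
  rw [DecBlock, hc]
  refine and_congr_right fun hp => ?_
  rcases Nat.eq_zero_or_pos l.length with h0 | h0
  · simp [List.length_eq_zero_iff.1 h0]
  · have hb : letter (e ++ l) (e.length + l.length) = l[l.length - 1] := by
      rw [← letter_succ (by omega), ← hs]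
      congr 1
      omega
    rw [hb]
    constructor
    · intro h a ha
      have hm := h (by omega)
      obtain ⟨i, hi, rfl⟩ := List.getElem_of_mem ha
      rcases Nat.lt_or_ge i (l.length - 1) with h1 | h1
      · exact hm.trans (List.pairwise_iff_getElem.1 hp i _ hi (by omega) h1).le
      · have : i = l.length - 1 := by omega
        subst this
        exact hm
    · intro h _
      exact h _ (List.getElem_mem _)

/-- Links the sublists that index the expansion of a product to the chains of inequalities. -/
theorem sublist_range'_iff (l : List ℕ) (k m : ℕ) :
    l.Sublist (List.range' k m) ↔ l.Pairwise (· < ·) ∧ ∀ a ∈ l, k ≤ a ∧ a < k + m := by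
  constructor
  · intro h
    refine ⟨(List.pairwise_lt_range' 1).sublist h, fun a ha => ?_⟩
    simpa using h.subset ha
  · rintro ⟨h1, h2⟩
    refine List.sublist_of_subperm_of_pairwise (r := (· < ·)) (List.subperm_of_subset ?_ ?_) h1
      (List.pairwise_lt_range' 1)
    · exact h1.imp fun h => h.ne
    · intro a ha
      simpa using h2 a ha

theorem sublist_range'_reverse_iff (l : List ℕ) (k m : ℕ) :
    l.Sublist (List.range' k m).reverse ↔
      l.Pairwise (· > ·) ∧ ∀ a ∈ l, k ≤ a ∧ a < k + m := by
  rw [← List.reverse_reverse l, List.reverse_sublist, sublist_range'_iff, List.pairwise_reverse]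
  simp

/-! ### Block boundaries and words built block by block -/

theorem gSum_succ {n i : ℕ} (v : ℕ → ℕ) (h : i + 1 ≤ n) :
    gSum n v (i + 1) = gSum n v i + v (n - (i + 1)) := by
  rw [gSum, gSum, Finset.sum_eq_sum_Ico_succ_bot (by omega), add_comm]
  congr 3
  omega

theorem fSum_succ (n i : ℕ) (u v : ℕ → ℕ) : fSum n u v (i + 1) = fSum n u v i + u (i + 1) := by
  rw [fSum, fSum, Finset.sum_Icc_succ_top (by omega), add_assoc]

theorem gSum_mono (n : ℕ) (v : ℕ → ℕ) : Monotone (gSum n v) := fun _ _ h =>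
  Finset.sum_le_sum_of_subset (Finset.Ico_subset_Ico (by omega) le_rfl)

theorem fSum_mono (n : ℕ) (u v : ℕ → ℕ) : Monotone (fSum n u v) := fun _ _ h =>
  Nat.add_le_add_left (Finset.sum_le_sum_of_subset (Finset.Icc_subset_Icc le_rfl h)) _

theorem fSum_zero (n : ℕ) (u v : ℕ → ℕ) : fSum n u v 0 = gSum n v (n - 1) := by
  simp [fSum]

/-- The words of length `g_i` that satisfy the first `i` conditions on increasing blocks. -/
def incWords (n : ℕ) (v : ℕ → ℕ) (i : ℕ) : Set (List ℕ) :=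
  {e | e.length = gSum n v i ∧ (∀ a ∈ e, 1 ≤ a ∧ a < n) ∧
    ∀ j, 1 ≤ j → j ≤ i → IncBlock e (n - j) (gSum n v (j - 1)) (gSum n v j)}

/-- The words of length `f_i` that satisfy all conditions on increasing blocks and the first `i`
conditions on decreasing blocks. -/
def decWords (n : ℕ) (u v : ℕ → ℕ) (i : ℕ) : Set (List ℕ) :=
  {e | e.length = fSum n u v i ∧ (∀ a ∈ e, 1 ≤ a ∧ a < n) ∧
    (∀ j, 1 ≤ j → j ≤ n - 1 → IncBlock e (n - j) (gSum n v (j - 1)) (gSum n v j)) ∧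
    ∀ j, 1 ≤ j → j ≤ i → DecBlock e j (fSum n u v (j - 1)) (fSum n u v j)}

/-- The words `e ++ l` with `e ∈ S` of length `N` and `l` a sublist of `L` of length `c`. -/
def extendWords (S : Set (List ℕ)) (N : ℕ) (L : List ℕ) (c : ℕ) : Set (List ℕ) :=
  {e | e.take N ∈ S ∧ (e.drop N).Sublist L ∧ (e.drop N).length = c}

theorem incWords_zero (n : ℕ) (v : ℕ → ℕ) : incWords n v 0 = {[]} := by
  ext e
  simp only [incWords, Set.mem_ofPred_eq, Set.mem_singleton_iff]
  constructor
  · rintro ⟨h, -⟩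
    simpa [gSum] using h
  · rintro rfl
    refine ⟨by simp [gSum], by simp, fun j h1 h2 => by omega⟩

theorem decWords_zero (n : ℕ) (u v : ℕ → ℕ) : decWords n u v 0 = incWords n v (n - 1) := by
  ext e
  simp only [decWords, incWords, Set.mem_ofPred_eq, fSum_zero]
  refine and_congr_right fun _ => and_congr_right fun _ =>
    ⟨fun h => h.1, fun h => ⟨h, fun j h1 h2 => by omega⟩⟩

/-- Earlier conditions see only the first g_i letters, so the last block can be split off. Its upper
bound n - 1 comes from the range of the letters. -/
theorem incWords_succ {n i : ℕ} (v : ℕ → ℕ) (h : i + 1 ≤ n - 1) :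
    incWords n v (i + 1) = extendWords (incWords n v i) (gSum n v i)
      (List.range' (n - (i + 1)) (i + 1)) (v (n - (i + 1))) := by
  have hg := gSum_succ v (show i + 1 ≤ n by omega)
  ext e
  suffices H : ∀ e₁ l : List ℕ, e₁.length = gSum n v i → (e₁ ++ l ∈ incWords n v (i + 1) ↔
      e₁ ∈ incWords n v i ∧ l.Sublist (List.range' (n - (i + 1)) (i + 1)) ∧
        l.length = v (n - (i + 1))) by
    by_cases he : gSum n v i ≤ e.length
    · have := H (e.take (gSum n v i)) (e.drop (gSum n v i)) (by simp [he])
      rwa [List.take_append_drop] at this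
    -- A word shorter than g_i belongs to neither side.
    · refine iff_of_false (fun h' => ?_) fun h' => ?_
      · have := h'.1
        omega
      · have := h'.1.1
        rw [List.length_take] at this
        omega
  intro e₁ l hl
  simp only [incWords, Set.mem_ofPred_eq, sublist_range'_iff, List.length_append, hg, hl,
    List.mem_append]
  constructor
  · rintro ⟨h1, h2, h3⟩
    have h4 := h3 (i + 1) (by omega) le_rfl
    rw [Nat.add_sub_cancel, hg, ← hl, ← Nat.add_left_cancel (hl ▸ h1 :
      e₁.length + l.length = e₁.length + v (n - (i + 1))), incBlock_append_right] at h4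
    refine ⟨⟨trivial, fun a ha => h2 a (Or.inl ha), fun j j1 j2 => ?_⟩,
      ⟨h4.1, fun a ha => ⟨h4.2 a ha, ?_⟩⟩, by omega⟩
    · exact (incBlock_append_left _ _ (hl ▸ gSum_mono n v j2)).1 (h3 j j1 (by omega))
    · have := h2 a (Or.inr ha)
      omega
  · rintro ⟨⟨-, h1, h2⟩, ⟨h3, h4⟩, h5⟩
    refine ⟨by omega, fun a ha => ?_, fun j j1 j2 => ?_⟩
    · rcases ha with ha | ha
      · exact h1 a ha
      · have := h4 a ha
        omega
    · rcases Nat.lt_or_ge i j with h6 | h6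
      · obtain rfl : j = i + 1 := by omega
        rw [Nat.add_sub_cancel, hg, ← hl, ← h5, incBlock_append_right]
        exact ⟨h3, fun a ha => (h4 a ha).1⟩
      · exact (incBlock_append_left _ _ (hl ▸ gSum_mono n v h6)).2 (h2 j j1 h6)

theorem decWords_succ (n i : ℕ) (u v : ℕ → ℕ) :
    decWords n u v (i + 1) = extendWords (decWords n u v i) (fSum n u v i)
      (List.range' (i + 1) (n - 1 - i)).reverse (u (i + 1)) := by
  have hg := fSum_succ n i u v
  ext e
  suffices H : ∀ e₁ l : List ℕ, e₁.length = fSum n u v i → (e₁ ++ l ∈ decWords n u v (i + 1) ↔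
      e₁ ∈ decWords n u v i ∧ l.Sublist (List.range' (i + 1) (n - 1 - i)).reverse ∧
        l.length = u (i + 1)) by
    by_cases he : fSum n u v i ≤ e.length
    · have := H (e.take (fSum n u v i)) (e.drop (fSum n u v i)) (by simp [he])
      rwa [List.take_append_drop] at this
    · refine iff_of_false (fun h' => ?_) fun h' => ?_
      · have := h'.1
        omega
      · have := h'.1.1
        rw [List.length_take] at this
        omega
  intro e₁ l hl
  -- All increasing blocks end by position g_{n-1} ≤ f_i, so the appended block does not affect
  -- them.
  have hi : ∀ j ≤ n - 1, gSum n v j ≤ e₁.length := fun j hj => by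
    rw [hl]
    exact (gSum_mono n v hj).trans (Nat.le_add_right _ _)
  simp only [decWords, Set.mem_ofPred_eq, sublist_range'_reverse_iff, List.length_append, hg, hl,
    List.mem_append]
  constructor
  · rintro ⟨h1, h2, h0, h3⟩
    have h4 := h3 (i + 1) (by omega) le_rfl
    rw [Nat.add_sub_cancel, hg, ← hl, ← Nat.add_left_cancel (hl ▸ h1 :
      e₁.length + l.length = e₁.length + u (i + 1)), decBlock_append_right] at h4
    refine ⟨⟨trivial, fun a ha => h2 a (Or.inl ha), fun j j1 j2 => ?_, fun j j1 j2 => ?_⟩,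
      ⟨h4.1, fun a ha => ⟨h4.2 a ha, ?_⟩⟩, by omega⟩
    · exact (incBlock_append_left _ _ (hi j j2)).1 (h0 j j1 j2)
    · exact (decBlock_append_left _ _ (hl ▸ fSum_mono n u v j2)).1 (h3 j j1 (by omega))
    · have := h2 a (Or.inr ha)
      omega
  · rintro ⟨⟨-, h1, h0, h2⟩, ⟨h3, h4⟩, h5⟩
    refine ⟨by omega, fun a ha => ?_, fun j j1 j2 => ?_, fun j j1 j2 => ?_⟩
    · rcases ha with ha | ha
      · exact h1 a ha
      · have := h4 a ha
        omega
    · exact (incBlock_append_left _ _ (hi j j2)).2 (h0 j j1 j2)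
    · rcases Nat.lt_or_ge i j with h6 | h6
      · obtain rfl : j = i + 1 := by omega
        rw [Nat.add_sub_cancel, hg, ← hl, ← h5, decBlock_append_right]
        exact ⟨h3, fun a ha => (h4 a ha).1⟩
      · exact (decBlock_append_left _ _ (hl ▸ fSum_mono n u v h6)).2 (h2 j j1 h6)

/-! ### Extraction of coefficients -/

/-- The variable `z` does not occur in the entries of `M`. -/
def VarFree {n : ℕ} (z : ℕ ⊕ ℕ) (M : Matrix (Equiv.Perm (Fin n)) (Equiv.Perm (Fin n)) Poly) :
    Prop :=
  ∀ v w (m : (ℕ ⊕ ℕ) →₀ ℕ), m z ≠ 0 → MvPolynomial.coeff m (M v w) = 0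

section VarFree

variable {n : ℕ} {z : ℕ ⊕ ℕ}

theorem coeff_mul_eq_zero {p q : Poly}
    (hp : ∀ m : (ℕ ⊕ ℕ) →₀ ℕ, m z ≠ 0 → MvPolynomial.coeff m p = 0)
    (hq : ∀ m : (ℕ ⊕ ℕ) →₀ ℕ, m z ≠ 0 → MvPolynomial.coeff m q = 0)
    (m : (ℕ ⊕ ℕ) →₀ ℕ) (hm : m z ≠ 0) : MvPolynomial.coeff m (p * q) = 0 := by
  rw [MvPolynomial.coeff_mul]
  refine Finset.sum_eq_zero fun a ha => ?_
  have h := DFunLike.congr_fun (Finset.HasAntidiagonal.mem_antidiagonal.1 ha) z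
  rw [Finsupp.add_apply] at h
  by_cases h1 : a.1 z = 0
  · rw [hq a.2 (by omega), mul_zero]
  · rw [hp a.1 h1, zero_mul]

theorem VarFree.mul {M M' : Matrix (Equiv.Perm (Fin n)) (Equiv.Perm (Fin n)) Poly}
    (h : VarFree z M) (h' : VarFree z M') : VarFree z (M * M') := by
  intro v w m hm
  rw [Matrix.mul_apply, MvPolynomial.coeff_sum]
  exact Finset.sum_eq_zero fun a _ => coeff_mul_eq_zero (h v a) (h' a w) m hm

theorem VarFree.one : VarFree z (1 : Matrix (Equiv.Perm (Fin n)) (Equiv.Perm (Fin n)) Poly) := by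
  intro v w m hm
  rw [Matrix.one_apply]
  split_ifs
  · rw [MvPolynomial.coeff_one, if_neg]
    rintro rfl
    exact hm rfl
  · simp

theorem VarFree.hElem {t : Poly} (ht : ∀ m : (ℕ ⊕ ℕ) →₀ ℕ, m z ≠ 0 → MvPolynomial.coeff m t = 0)
    (i : ℕ) : VarFree z (hElem (genMat n Poly) t i) := by
  intro v w m hm
  rw [DoubleSchubert.hElem, Matrix.add_apply, MvPolynomial.coeff_add, VarFree.one v w m hm,
    zero_add, Matrix.smul_apply, smul_eq_mul, genMat, Matrix.of_apply]
  split_ifs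
  · rw [mul_one, ht m hm]
  · simp

theorem VarFree.decProd {t : Poly}
    (ht : ∀ m : (ℕ ⊕ ℕ) →₀ ℕ, m z ≠ 0 → MvPolynomial.coeff m t = 0) (l k : ℕ) :
    VarFree z (decProd (genMat n Poly) t l k) := by
  induction l generalizing k with
  | zero => exact VarFree.one
  | succ l ih => exact (ih _).mul (VarFree.hElem ht k)

theorem VarFree.incProd {t : Poly}
    (ht : ∀ m : (ℕ ⊕ ℕ) →₀ ℕ, m z ≠ 0 → MvPolynomial.coeff m t = 0) (l k : ℕ) :
    VarFree z (incProd (genMat n Poly) t l k) := by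
  induction l generalizing k with
  | zero => exact VarFree.one
  | succ l ih => exact (VarFree.hElem ht k).mul (ih _)

theorem coeff_X_eq_zero {z' : ℕ ⊕ ℕ} (h : z' ≠ z) (m : (ℕ ⊕ ℕ) →₀ ℕ) (hm : m z ≠ 0) :
    MvPolynomial.coeff m (MvPolynomial.X z' : Poly) = 0 := by
  rw [MvPolynomial.coeff_X, if_neg]
  rintro rfl
  exact hm (Finsupp.single_eq_of_ne h.symm)

theorem coeff_y_eq_zero {j : ℕ} (h : Sum.inr j ≠ z) (m : (ℕ ⊕ ℕ) →₀ ℕ) (hm : m z ≠ 0) :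
    MvPolynomial.coeff m (-y j) = 0 := by
  rw [MvPolynomial.coeff_neg, y, coeff_X_eq_zero h m hm, neg_zero]

theorem VarFree.yProd (l k j : ℕ) (h : ∀ i, j ≤ i → Sum.inr i ≠ z) :
    VarFree z (yProd (genMat n Poly) y l k j) := by
  induction l generalizing k j with
  | zero => exact VarFree.one
  | succ l ih =>
    exact (ih _ _ fun i hi => h i (by omega)).mul
      (VarFree.incProd (coeff_y_eq_zero (h j le_rfl)) _ _)

end VarFree

/-! ### Expansion of products into words -/

theorem listProd_eq_sum {R A : Type*} [CommRing R] [Ring A] [Algebra R A] (u : ℕ → A) (t : R)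
    (L : List ℕ) : listProd u (L.map fun a => (a, t)) =
      (L.sublists'.map fun l => t ^ l.length • (l.map u).prod).sum := by
  induction L with
  | nil => simp [listProd]
  | cons a L ih =>
    have h : listProd u ((a :: L).map fun a => (a, t)) =
        hElem u t a * listProd u (L.map fun a => (a, t)) := by simp [listProd]
    rw [h, List.sublists'_cons, List.map_append, List.sum_append, ← ih, hElem, add_mul, one_mul]
    congr 1
    rw [ih, ← List.sum_map_mul_left, List.map_map]
    congr 1
    refine List.map_congr_left fun l _ => ?_
    simp [pow_succ, mul_smul]

theorem decProd_eq_listProd {R A : Type*} [CommRing R] [Ring A] [Algebra R A] (u : ℕ → A) (t : R)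
    (m k : ℕ) : decProd u t m k = listProd u ((List.range' k m).reverse.map fun a => (a, t)) := by
  induction m generalizing k with
  | zero => simp [decProd, listProd]
  | succ m ih =>
    rw [decProd, ih, List.range'_succ, List.reverse_cons, List.map_append, listProd_append]
    simp [listProd]

theorem incProd_eq_listProd {R A : Type*} [CommRing R] [Ring A] [Algebra R A] (u : ℕ → A) (t : R)
    (m k : ℕ) : incProd u t m k = listProd u ((List.range' k m).map fun a => (a, t)) := by
  induction m generalizing k with
  | zero => simp [incProd, listProd]
  | succ m ih =>
    rw [incProd, ih, List.range'_succ, List.map_cons]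
    simp [listProd]

theorem wordMat_eq_C (n : ℕ) (e : List ℕ) (v w : Equiv.Perm (Fin n)) :
    wordMat n Poly e v w = MvPolynomial.C (wordMat n ℤ e v w) := by
  rw [wordMat_apply, wordMat_apply]
  split_ifs <;> simp

/-- The coefficients of `m` in the entries of `M` are those of the sum of the words in `S`, up to
the factor `s`. -/
def HasWordCoeff {n : ℕ} (M : Matrix (Equiv.Perm (Fin n)) (Equiv.Perm (Fin n)) Poly)
    (m : (ℕ ⊕ ℕ) →₀ ℕ) (s : ℤ) (S : Set (List ℕ)) : Prop :=
  ∃ F : Finset (List ℕ), (∀ e, e ∈ F ↔ e ∈ S) ∧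
    ∀ v w, MvPolynomial.coeff m (M v w) = s * ∑ e ∈ F, wordMat n ℤ e v w

theorem hasWordCoeff_one (n : ℕ) :
    HasWordCoeff (1 : Matrix (Equiv.Perm (Fin n)) (Equiv.Perm (Fin n)) Poly) 0 1 {[]} := by
  refine ⟨{[]}, by simp, fun v w => ?_⟩
  simp only [wordMat, Finset.sum_singleton, List.map_nil, List.prod_nil, Matrix.one_apply]
  split_ifs <;> simp

/-- As `p` is free of `z`, the exponent of `z` in the product is exactly `k`. -/
theorem coeff_mul_C_mul_X_pow {z : ℕ ⊕ ℕ} {p : Poly}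
    (hp : ∀ m : (ℕ ⊕ ℕ) →₀ ℕ, m z ≠ 0 → MvPolynomial.coeff m p = 0)
    {m : (ℕ ⊕ ℕ) →₀ ℕ} (hm : m z = 0) (c k : ℕ) (a r : ℤ) :
    MvPolynomial.coeff (m + Finsupp.single z c)
      (p * ((MvPolynomial.C a * MvPolynomial.X z) ^ k * MvPolynomial.C r)) =
      if k = c then a ^ c * (MvPolynomial.coeff m p * r) else 0 := by
  have h : ((MvPolynomial.C a * MvPolynomial.X z) ^ k * MvPolynomial.C r : Poly) =
      MvPolynomial.monomial (Finsupp.single z k) (a ^ k * r) := by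
    rw [mul_pow, ← MvPolynomial.C_pow, mul_right_comm, ← MvPolynomial.C_mul,
      MvPolynomial.C_mul_X_pow_eq_monomial]
  rw [h, MvPolynomial.coeff_mul_monomial']
  rcases lt_trichotomy k c with hk | rfl | hk
  · rw [if_neg hk.ne]
    split_ifs with hle
    · rw [hp, zero_mul]
      simp [hm]
      omega
    · rfl
  · rw [if_pos (by simp), if_pos rfl, add_tsub_cancel_right]
    ring
  · rw [if_neg hk.ne', if_neg]
    intro hle
    have := hle z
    simp [hm] at this
    omega

/-- The inductive step of the extraction: a factor in a fresh variable z contributes to z^c exactly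
through its sublists of length `c`. -/
theorem HasWordCoeff.mul_listProd {n : ℕ}
    {M : Matrix (Equiv.Perm (Fin n)) (Equiv.Perm (Fin n)) Poly} {m : (ℕ ⊕ ℕ) →₀ ℕ} {s : ℤ}
    {S : Set (List ℕ)} (h : HasWordCoeff M m s S) {N : ℕ} (hN : ∀ e ∈ S, e.length = N)
    {z : ℕ ⊕ ℕ} (hM : VarFree z M) (hm : m z = 0) {L : List ℕ} (hL : L.Nodup) (a : ℤ) (c : ℕ) :
    HasWordCoeff (M * listProd (genMat n Poly)
      (L.map fun b => (b, MvPolynomial.C a * MvPolynomial.X z)))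
      (m + Finsupp.single z c) (s * a ^ c) (extendWords S N L c) := by
  classical
  obtain ⟨F, hF, hc⟩ := h
  set D : Finset (List ℕ) := L.sublists'.toFinset.filter fun l => l.length = c with hD
  have mem_D : ∀ l, l ∈ D ↔ l.Sublist L ∧ l.length = c := fun l => by simp [hD]
  have hF' : ∀ e ∈ F, e.length = N := fun e he => hN e ((hF e).1 he)
  refine ⟨(F ×ˢ D).image fun p => p.1 ++ p.2, fun e => ?_, fun v w => ?_⟩
  · simp only [Finset.mem_image, Finset.mem_product, Prod.exists, extendWords, Set.mem_ofPred_eq,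
      ← mem_D, ← hF]
    constructor
    · rintro ⟨e₁, l, ⟨h1, h2⟩, rfl⟩
      rw [List.take_left' (hF' _ h1), List.drop_left' (hF' _ h1)]
      exact ⟨h1, h2⟩
    · rintro ⟨h1, h2⟩
      exact ⟨_, _, ⟨h1, h2⟩, List.take_append_drop _ _⟩
  · have hE : listProd (genMat n Poly) (L.map fun b => (b, MvPolynomial.C a * MvPolynomial.X z)) =
        ∑ l ∈ L.sublists'.toFinset,
          ((MvPolynomial.C a * MvPolynomial.X z) ^ l.length : Poly) • wordMat n Poly l := by
      rw [listProd_eq_sum, List.sum_toFinset _ (List.nodup_sublists'.2 hL)]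
      rfl
    -- The common length `N` makes the cut of a concatenation unique, so no word is counted twice.
    have hinj : Set.InjOn (fun p : List ℕ × List ℕ => p.1 ++ p.2) ↑(F ×ˢ D) := by
      rintro ⟨e₁, l₁⟩ h1 ⟨e₂, l₂⟩ h2 h
      simp only [Finset.coe_product, Set.mem_prod, Finset.mem_coe] at h1 h2
      have := List.append_inj h (by rw [hF' _ h1.1, hF' _ h2.1])
      exact Prod.ext this.1 this.2
    rw [Finset.sum_image hinj, Finset.sum_product_right, hE, Finset.mul_sum, Matrix.sum_apply,
      MvPolynomial.coeff_sum, hD, Finset.sum_filter, Finset.mul_sum]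
    refine Finset.sum_congr rfl fun l _ => ?_
    rw [Matrix.mul_apply, MvPolynomial.coeff_sum]
    simp only [Matrix.smul_apply, smul_eq_mul, wordMat_eq_C, coeff_mul_C_mul_X_pow (hM _ _) hm]
    split_ifs with hl
    · simp only [hc, wordMat_append, Matrix.mul_apply, Finset.mul_sum, Finset.sum_mul]
      rw [Finset.sum_comm]
      refine Finset.sum_congr rfl fun e _ => Finset.sum_congr rfl fun v' _ => ?_
      ring
    · simp

/-- The exponents of the last `i` variables `y`. -/
noncomputable def yExp (n : ℕ) (v : ℕ → ℕ) (i : ℕ) : (ℕ ⊕ ℕ) →₀ ℕ :=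
  ∑ k ∈ Finset.Ico (n - i) n, Finsupp.single (Sum.inr k) (v k)

/-- The exponents of all variables `y` and of the first `i` variables `x`. -/
noncomputable def xyExp (n : ℕ) (u v : ℕ → ℕ) (i : ℕ) : (ℕ ⊕ ℕ) →₀ ℕ :=
  yExp n v (n - 1) + ∑ k ∈ Finset.Icc 1 i, Finsupp.single (Sum.inl k) (u k)

theorem yExp_succ {n i : ℕ} (v : ℕ → ℕ) (h : i + 1 ≤ n) :
    yExp n v (i + 1) = yExp n v i + Finsupp.single (Sum.inr (n - (i + 1))) (v (n - (i + 1))) := by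
  rw [yExp, yExp, Finset.sum_eq_sum_Ico_succ_bot (by omega), add_comm,
    show n - (i + 1) + 1 = n - i by omega]

theorem xyExp_succ (n i : ℕ) (u v : ℕ → ℕ) :
    xyExp n u v (i + 1) = xyExp n u v i + Finsupp.single (Sum.inl (i + 1)) (u (i + 1)) := by
  rw [xyExp, xyExp, Finset.sum_Icc_succ_top (by omega), add_assoc]

theorem xyExp_last (n : ℕ) (u v : ℕ → ℕ) : xyExp n u v (n - 1) = expVec n u v := by
  rw [xyExp, yExp, expVec, Finset.sum_add_distrib, add_comm]
  have h1 : Finset.Icc 1 (n - 1) = Finset.Ico 1 n := by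
    ext a
    simp only [Finset.mem_Icc, Finset.mem_Ico]
    omega
  have h2 : Finset.Ico (n - (n - 1)) n = Finset.Ico 1 n := by
    ext a
    simp only [Finset.mem_Ico]
    omega
  rw [h1, h2]

theorem neg_y_eq (j : ℕ) : -y j = MvPolynomial.C (-1) * MvPolynomial.X (Sum.inr j) := by
  simp [y]

theorem x_eq (i : ℕ) : x i = MvPolynomial.C 1 * MvPolynomial.X (Sum.inl i) := by
  simp [x]

theorem hasWordCoeff_yProd (n : ℕ) (v : ℕ → ℕ) (i : ℕ) (hi : i ≤ n - 1) :
    HasWordCoeff (yProd (genMat n Poly) y i (n - i) (n - i)) (yExp n v i)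
      ((-1) ^ gSum n v i) (incWords n v i) := by
  induction i with
  | zero =>
    have := hasWordCoeff_one n
    simpa [yProd, yExp, gSum, incWords_zero] using this
  | succ i ih =>
    have h : yProd (genMat n Poly) y (i + 1) (n - (i + 1)) (n - (i + 1)) =
        yProd (genMat n Poly) y i (n - i) (n - i) * listProd (genMat n Poly)
          ((List.range' (n - (i + 1)) (i + 1)).map fun b =>
            (b, (MvPolynomial.C (-1) * MvPolynomial.X (Sum.inr (n - (i + 1))) : Poly))) := by
      rw [← neg_y_eq, ← incProd_eq_listProd, yProd, show n - (i + 1) + 1 = n - i by omega]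
    rw [h, yExp_succ v (by omega), gSum_succ v (by omega), pow_add, incWords_succ v hi]
    refine (ih (by omega)).mul_listProd (fun e he => he.1) (VarFree.yProd _ _ _ ?_) ?_
      List.nodup_range' _ _
    · intro j hj
      simp only [ne_eq, Sum.inr.injEq]
      omega
    · rw [yExp, Finsupp.finsetSum_apply]
      refine Finset.sum_eq_zero fun k hk => Finsupp.single_eq_of_ne ?_
      simp only [Finset.mem_Ico] at hk
      simp only [ne_eq, Sum.inr.injEq]
      omega

/-- The product of `yProd` and the first `r` factors of `xProd`. -/
noncomputable def partialProd (n : ℕ) : ℕ → Matrix (Equiv.Perm (Fin n)) (Equiv.Perm (Fin n)) Poly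
  | 0 => yProd (genMat n Poly) y (n - 1) 1 1
  | r + 1 => partialProd n r * decProd (genMat n Poly) (x (r + 1)) (n - 1 - r) (r + 1)

theorem partialProd_mul_xProd (n r : ℕ) (hr : r ≤ n - 1) :
    partialProd n r * xProd (genMat n Poly) x (n - 1 - r) (r + 1) (r + 1) =
      schubertMat n x y := by
  induction r with
  | zero => rfl
  | succ r ih =>
    rw [← ih (by omega), partialProd, mul_assoc, xProd_pred _ _ (n - 1 - r),
      show n - 1 - r - 1 = n - 1 - (r + 1) by omega]

theorem varFree_partialProd (n r i : ℕ) (hi : r < i) :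
    VarFree (Sum.inl i) (partialProd n r) := by
  induction r with
  | zero => exact VarFree.yProd _ _ _ (by simp)
  | succ r ih =>
    refine (ih (by omega)).mul (VarFree.decProd (coeff_X_eq_zero ?_) _ _)
    simp only [ne_eq, Sum.inl.injEq]
    omega

theorem hasWordCoeff_partialProd (n : ℕ) (u v : ℕ → ℕ) (r : ℕ) (hr : r ≤ n - 1) :
    HasWordCoeff (partialProd n r) (xyExp n u v r)
      ((-1) ^ gSum n v (n - 1)) (decWords n u v r) := by
  induction r with
  | zero =>
    rw [decWords_zero]
    have := hasWordCoeff_yProd n v (n - 1) le_rfl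
    -- For `n = 0` truncation gives n - (n - 1) = 0 instead of 1, but the products are empty.
    rcases Nat.eq_zero_or_pos n with rfl | h
    · simpa [partialProd, xyExp, yProd] using this
    · rw [show n - (n - 1) = 1 by omega] at this
      simpa [partialProd, xyExp] using this
  | succ r ih =>
    have h : partialProd n (r + 1) = partialProd n r * listProd (genMat n Poly)
        ((List.range' (r + 1) (n - 1 - r)).reverse.map fun b =>
          (b, (MvPolynomial.C 1 * MvPolynomial.X (Sum.inl (r + 1)) : Poly))) := by
      rw [← x_eq, ← decProd_eq_listProd, partialProd]
    rw [h, xyExp_succ, decWords_succ]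
    have := (ih (by omega)).mul_listProd (fun e he => he.1)
      (varFree_partialProd n r (r + 1) (by omega)) ?_
      (List.nodup_reverse.2 (List.nodup_range' (s := r + 1) (n := n - 1 - r))) 1 (u (r + 1))
    · rwa [one_pow, mul_one] at this
    · rw [xyExp, yExp, Finsupp.add_apply, Finsupp.finsetSum_apply, Finsupp.finsetSum_apply,
        Finset.sum_eq_zero, Finset.sum_eq_zero, add_zero]
      · intro k hk
        refine Finsupp.single_eq_of_ne ?_
        simp only [Finset.mem_Icc] at hk
        simp only [ne_eq, Sum.inl.injEq]
        omega
      · intro k _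
        exact Finsupp.single_eq_of_ne (by simp)

/-- The coefficients of the double Schubert polynomials. -/
theorem coeff_doubleSchubert (n : ℕ) (w : Equiv.Perm (Fin n)) (u v : ℕ → ℕ)
    (hdeg : ∑ k ∈ Finset.Ico 1 n, (u k + v k) = len w) :
    MvPolynomial.coeff (expVec n u v) (doubleSchubert w) =
      (-1 : ℤ) ^ gSum n v (n - 1) *
        (Set.ncard {e : List ℕ | IsReducedWord w e ∧
          ∀ i, 1 ≤ i → i ≤ n - 1 →
            IncBlock e (n - i)
              (gSum n v (i - 1)) (gSum n v i) ∧
            DecBlock e i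
              (fSum n u v (i - 1)) (fSum n u v i)} : ℤ) := by
  classical
  obtain ⟨F, hF, hc⟩ := hasWordCoeff_partialProd n u v (n - 1) le_rfl
  have hS : partialProd n (n - 1) = schubertMat n x y := by
    have := partialProd_mul_xProd n (n - 1) le_rfl
    rwa [Nat.sub_self, xProd, mul_one] at this
  -- The degree hypothesis makes the prescribed total length of the blocks equal to ℓ(w), so the
  -- words counted are reduced.
  have hf : fSum n u v (n - 1) = len w := by
    have h1 : Finset.Icc 1 (n - 1) = Finset.Ico 1 n := by
      ext a
      simp only [Finset.mem_Icc, Finset.mem_Ico]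
      omega
    have h2 : Finset.Ico (n - (n - 1)) n = Finset.Ico 1 n := by
      ext a
      simp only [Finset.mem_Ico]
      omega
    rw [← hdeg, fSum, gSum, h1, h2, Finset.sum_add_distrib, add_comm]
  rw [doubleSchubert_eq_schubertMat, ← hS, ← xyExp_last, hc]
  congr 1
  simp only [wordMat_apply]
  rw [Finset.sum_boole, ← Set.ncard_coe_finset]
  congr 2
  ext e
  simp only [Finset.coe_filter, Set.mem_ofPred_eq, hF, decWords, IsReducedWord, IsWord, len_one,
    zero_add, one_mul, hf]
  constructor
  · rintro ⟨⟨h1, h2, h3, h4⟩, -, h5, -⟩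
    exact ⟨⟨⟨h2, h5⟩, h1⟩, fun i i1 i2 => ⟨h3 i i1 i2, h4 i i1 i2⟩⟩
  · rintro ⟨⟨⟨h2, h5⟩, h1⟩, h⟩
    exact ⟨⟨h1, h2, fun i i1 i2 => (h i i1 i2).1, fun i i1 i2 => (h i i1 i2).2⟩, h2, h5, h1.symm⟩

end DoubleSchubert

theorem mainTheorem6 (n : ℕ) (w : Equiv.Perm (Fin n)) (u v : ℕ → ℕ)
    (hdeg : ∑ k ∈ Finset.Ico 1 n, (u k + v k) = DoubleSchubert.len w) :
    MvPolynomial.coeff (DoubleSchubert.expVec n u v) (DoubleSchubert.doubleSchubert w) =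
      (-1 : ℤ) ^ DoubleSchubert.gSum n v (n - 1) *
        (Set.ncard {e : List ℕ | DoubleSchubert.IsReducedWord w e ∧
          ∀ i, 1 ≤ i → i ≤ n - 1 →
            DoubleSchubert.IncBlock e (n - i)
              (DoubleSchubert.gSum n v (i - 1)) (DoubleSchubert.gSum n v i) ∧
            DoubleSchubert.DecBlock e i
              (DoubleSchubert.fSum n u v (i - 1)) (DoubleSchubert.fSum n u v i)} : ℤ) :=
  DoubleSchubert.coeff_doubleSchubert n w u v hdeg
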